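/- **Notation.** Let $X,Y$ be (real or complex) Banach spaces, $\mathbb R_-=(-\infty,0]$, $\mathbb R_+=[0,\infty)$, and $r'=r/(r-1)$ for $r\in(1,\infty)$, $r'=\infty$ for $r=1$. Functions on a half-line are extended by $0$ to $\mathbb R$. For $I\in\{\mathbb R_-,\mathbb R_+\}$, $L^\infty_c(I;X)$ is the space of measurable, essentially bounded $f:I\to X$ of compact support. A *kernel* on $I\times I$ is a measurable $K:I\times I\to\mathcal L(X,Y)$ with $K(t,\cdot)\in L^1_{loc}(I\setminus\{t\};\mathcal L(X,Y))$ for every $t\in I$. A bounded linear operator $T:L^{p_0}(I;X)\to L^{p_0}(I;Y)$, for some $p_0\in(1,\infty)$, is a *singular integral operator* with kernel $K$ if $Tf(t)=\int_I K(t,s)f(s)\,ds$ for every $f\in L^\infty_c(I;X)$ and (almost) every $t\in I\setminus\operatorname{supp}f$. Put $$M^+_-g(t)=\chi_{\mathbb R_-}(t)\sup_{h>0}\frac1h\int_t^{t+h}|g|\,ds,\qquad M^-_+g(t)=\chi_{\mathbb R_+}(t)\sup_{h>0}\frac1h\int_{t-h}^{t}|g|\,ds ,$$ for $g$ on $\mathbb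 R_-$, respectively on $\mathbb R_+$. For $r\in[1,\infty)$ let $$[K]_{D_{r,-}}=\sup_{s<0,\,h>0}h^{1/r'}\sum_{m\ge1}2^{m/r'}\Big(\int_{\{t\le0:\ 2^mh<s-t\le2^{m+1}h\}}\|K(t,s)-K(t,s-h)\|^r\,dt\Big)^{1/r},$$ $$[K]_{D'_{r,-}}=\sup_{t<0,\,h>0}h^{1/r'}\sum_{m\ge1}2^{m/r'}\Big(\int_{\{s\le0:\ 2^mh<s-t\le2^{m+1}h\}}\|K(t,s)-K(t+h,s)\|^r\,ds\Big)^{1/r},$$ and on $\mathbb R_+$ $$[K]_{D_{r,+}}=\sup_{s>0,\,h>0}h^{1/r'}\sum_{m\ge1}2^{m/r'}\Big(\int_{\{t\ge0:\ 2^mh<t-s\le2^{m+1}h\}}\|K(t,s)-K(t,s+h)\|^r\,dt\Big)^{1/r},$$ $$[K]_{D'_{r,+}}=\sup_{t>0,\,h>0}h^{1/r'}\sum_{m\ge1}2^{m/r'}\Big(\int_{\{s\ge0:\ 2^mh<t-s\le2^{m+1}h\}}\|K(t,s)-K(t-h,s)\|^r\,ds\Big)^{1/r}.$$ $K$ *satisfies*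 $(D_{r,\pm})$ or $(D'_{r,\pm})$ if the respective quantity is finite. A *weight* on $I$ is a measurable $w:I\to[0,\infty)$ with $w>0$ a.e.; $w(S)=\int_S w\,dt$. For $p\in(1,\infty)$, $w\in A^+_p(\mathbb R_-)$ means that $w$ is a weight on $\mathbb R_-$ with $$[w]_{A^+_p(\mathbb R_-)}=\sup_{a<b<c\le0}\frac1{(c-a)^p}\int_a^bw\,dt\Big(\int_b^cw^{1-p'}dt\Big)^{p-1}<\infty ,$$ and $w\in A^-_p(\mathbb R_+)$ means $w(-\cdot)\in A^+_p(\mathbb R_-)$, with $[w]_{A^-_p(\mathbb R_+)}=[w(-\cdot)]_{A^+_p(\mathbb R_-)}$. A weight $w$ on $\mathbb R_-$ is in $A^+_\infty(\mathbb R_-)$ if there are $C,\delta>0$ with $\frac{|S|}{c-a}\le C\big(\frac{w(S)}{w(a,b)}\big)^\delta$ for all $a<b<c\le0$ and measurable $S\subseteq[b,c]$; a weight $w$ on $\mathbb R_+$ is in $A^-_\infty(\mathbb R_+)$ if there are $C,\delta>0$ with $\frac{|S|}{c-a}\le C\big(\frac{w(S)}{w(b,c)}\big)^\delta$ for all $0\le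 a<b<c$ and measurable $S\subseteq[a,b]$. **Theorem.** (A) Let $T$ be a singular integral operator on $\mathbb R_-$ with a kernel $K$ supported in $\{(t,s)\in\mathbb R_-\times\mathbb R_-:t<s\}$ satisfying $(D_{1,-})$ and, for some $r\in(1,\infty)$, $(D'_{r,-})$. 1. For every $p\in(0,\infty)$ and every $w\in A^+_\infty(\mathbb R_-)$ there is a finite constant $C$ such that $$\int_{\mathbb R_-}|Tf|_Y^p\,w\,dt\le C\int_{\mathbb R_-}\big(M^+_-(|f|_X^{r'})\big)^{p/r'}w\,dt$$ for every $f\in L^\infty_c(\mathbb R_-;X)$ with $M^+_-(|Tf|_Y)\in L^p_w(\mathbb R_-)$, that is, with $\int_{\mathbb R_-}(M^+_-(|Tf|_Y))^pw\,dt<\infty$. 2. If $p\in(1,\infty)$ and $\mathcal F\subseteq A^+_p(\mathbb R_-)$ satisfies $\sup_{w\in\mathcal F}[w]_{A^+_p(\mathbb R_-)}<\infty$, then the inequality in 1 holds, for this $p$, with one finite constant $C$ for all $w\in\mathcal F$. (B) Let $T$ be a singular integral operator on $\mathbb R_+$ with a kernel $K$ supported in $\{(t,s)\in\mathbb R_+\times\mathbb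 R_+:t>s\}$ satisfying $(D_{1,+})$ and, for some $r\in(1,\infty)$, $(D'_{r,+})$. Then 1 and 2 hold with $\mathbb R_-$, $M^+_-$, $A^+_\infty(\mathbb R_-)$, $A^+_p(\mathbb R_-)$ replaced by $\mathbb R_+$, $M^-_+$, $A^-_\infty(\mathbb R_+)$, $A^-_p(\mathbb R_+)$. -/

import Mathlib

open MeasureTheory Set
open scoped ENNReal NNReal Topology

noncomputable section

/-! Functions on the half-line `(-∞, 0] = Iic 0` or `[0, ∞) = Ici 0` are represented by functions
on `ℝ`; every definition only looks at their values on the half-line. -/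

/-- `(1 / h) ∫_t^{t+h} g`, maximised over `h > 0`. -/
def maxFwd (g : ℝ → ℝ≥0∞) (t : ℝ) : ℝ≥0∞ :=
  ⨆ (h : ℝ) (_ : 0 < h), (∫⁻ s in Ioc t (t + h), g s) / ENNReal.ofReal h

/-- `(1 / h) ∫_{t-h}^t g`, maximised over `h > 0`. -/
def maxBwd (g : ℝ → ℝ≥0∞) (t : ℝ) : ℝ≥0∞ :=
  ⨆ (h : ℝ) (_ : 0 < h), (∫⁻ s in Ioc (t - h) t, g s) / ENNReal.ofReal h

/-- The operator `M^+_-`: extend `g` from `(-∞, 0]` by zero, apply the forward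
maximal operator and restrict the result to `(-∞, 0]`. -/
def maxFwdNeg (g : ℝ → ℝ≥0∞) : ℝ → ℝ≥0∞ :=
  (Iic (0 : ℝ)).indicator (maxFwd ((Iic (0 : ℝ)).indicator g))

/-- The operator `M^-_+`: extend `g` from `[0, ∞)` by zero, apply the backward
maximal operator and restrict the result to `[0, ∞)`. -/
def maxBwdPos (g : ℝ → ℝ≥0∞) : ℝ → ℝ≥0∞ :=
  (Ici (0 : ℝ)).indicator (maxBwd ((Ici (0 : ℝ)).indicator g))

/-- A weight on `I`: measurable, finite-valued, nonnegative and almost everywhere positive. -/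
structure IsWeightOn (I : Set ℝ) (w : ℝ → ℝ≥0) : Prop where
  aemeasurable : AEMeasurable w (volume.restrict I)
  pos : ∀ᵐ t ∂volume.restrict I, 0 < w t

/-- `w(S) = ∫_S w`. -/
def wMass (w : ℝ → ℝ≥0) (S : Set ℝ) : ℝ≥0∞ := ∫⁻ t in S, (w t : ℝ≥0∞)

/-- The constant `[w]_{A_p^+(ℝ_-)}`. -/
def apFwdNegConst (p : ℝ) (w : ℝ → ℝ≥0) : ℝ≥0∞ :=
  ⨆ (a : ℝ) (b : ℝ) (c : ℝ) (_ : a < b) (_ : b < c) (_ : c ≤ 0),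
    wMass w (Ioc a b) * (∫⁻ t in Ioc b c, (w t : ℝ≥0∞) ^ (1 - p.conjExponent)) ^ (p - 1)
      / ENNReal.ofReal (c - a) ^ p

/-- The class `A_p^+(ℝ_-)`, for `1 < p < ∞`. -/
def ApFwdNeg (p : ℝ) (w : ℝ → ℝ≥0) : Prop :=
  IsWeightOn (Iic 0) w ∧ apFwdNegConst p w < ∞

/-- The constant `[w]_{A_p^-(ℝ_+)} = [w(-·)]_{A_p^+(ℝ_-)}`. -/
def apBwdPosConst (p : ℝ) (w : ℝ → ℝ≥0) : ℝ≥0∞ := apFwdNegConst p fun t => w (-t)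

/-- The class `A_p^-(ℝ_+)`, for `1 < p < ∞`. -/
def ApBwdPos (p : ℝ) (w : ℝ → ℝ≥0) : Prop := ApFwdNeg p fun t => w (-t)

/-- The class `A_∞^+(ℝ_-)`. -/
def AInftyFwdNeg (w : ℝ → ℝ≥0) : Prop :=
  IsWeightOn (Iic 0) w ∧ ∃ C > (0 : ℝ), ∃ δ > (0 : ℝ), ∀ a b c : ℝ, a < b → b < c → c ≤ 0 →
    ∀ S : Set ℝ, MeasurableSet S → S ⊆ Icc b c →
      volume S / ENNReal.ofReal (c - a) ≤
        ENNReal.ofReal C * (wMass w S / wMass w (Ioo a b)) ^ δ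

/-- The class `A_∞^-(ℝ_+)`. -/
def AInftyBwdPos (w : ℝ → ℝ≥0) : Prop :=
  IsWeightOn (Ici 0) w ∧ ∃ C > (0 : ℝ), ∃ δ > (0 : ℝ), ∀ a b c : ℝ, 0 ≤ a → a < b → b < c →
    ∀ S : Set ℝ, MeasurableSet S → S ⊆ Icc a b →
      volume S / ENNReal.ofReal (c - a) ≤
        ENNReal.ofReal C * (wMass w S / wMass w (Ioo b c)) ^ δ

/-- `f ∈ L_c^∞(I; X)`, for a closed set `I`: `f` is strongly measurable, essentially bounded, of
compact support, and (as a function on `ℝ`) vanishes outside `I`. -/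
structure IsLInftyC {X : Type*} [NormedAddCommGroup X] (I : Set ℝ) (f : ℝ → X) : Prop where
  memLp_top : MemLp f ∞ volume
  hasCompactSupport : HasCompactSupport f
  support_subset : Function.support f ⊆ I

theorem IsLInftyC.memLp {X : Type*} [NormedAddCommGroup X] {I : Set ℝ} {f : ℝ → X}
    (hf : IsLInftyC I f) (p : ℝ≥0∞) : MemLp f p (volume.restrict I) :=
  (hf.memLp_top.mono_exponent_of_measure_support_ne_top (s := tsupport f)
    (fun _ hx => image_eq_zero_of_notMem_tsupport hx)
    hf.hasCompactSupport.isCompact.measure_lt_top.ne le_top).restrict I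

section Operators

variable {𝕜 : Type*} [RCLike 𝕜]
  {X : Type*} [NormedAddCommGroup X] [NormedSpace 𝕜 X]
  {Y : Type*} [NormedAddCommGroup Y] [NormedSpace 𝕜 Y]

/-- A kernel on `I × I`: a (Bochner, Lebesgue) measurable operator-valued function such that
`K(t, ·) ∈ L^1_loc(I \ {t})` for every `t ∈ I`. -/
structure IsKernelOn (I : Set ℝ) (K : ℝ → ℝ → X →L[𝕜] Y) : Prop where
  aestronglyMeasurable : AEStronglyMeasurable (Function.uncurry K)
    ((volume.restrict I).prod (volume.restrict I))
  locallyIntegrableOn : ∀ t ∈ I, LocallyIntegrableOn (K t) (I \ {t})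

/-- The bounded operator `T : L^{p₀}(I; X) → L^{p₀}(I; Y)` is a singular integral operator with
kernel `K`: `Tf(t) = ∫_I K(t, s) f(s) ds` for every `f ∈ L_c^∞(I; X)` and (since `Tf` is a class
of functions) almost every `t ∈ I` outside the support of `f`. -/
structure IsSingularIntegralOperator [NormedSpace ℝ Y] (I : Set ℝ) {p₀ : ℝ≥0∞} [Fact (1 ≤ p₀)]
    (T : Lp X p₀ (volume.restrict I) →L[𝕜] Lp Y p₀ (volume.restrict I))
    (K : ℝ → ℝ → X →L[𝕜] Y) : Prop where
  isKernelOn : IsKernelOn I K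
  eq_integral : ∀ (f : ℝ → X) (hf : IsLInftyC I f), ∀ᵐ t ∂volume.restrict I,
    t ∉ tsupport f → T ((hf.memLp p₀).toLp f) t = ∫ s in I, K t s (f s)

/-- `[K]_{D_{r,-}}`; the summation index `m ≥ 1` is written `m + 1`, and `1 / r' = 1 - 1 / r`
(which is `0` for `r = 1`). -/
def dNeg (r : ℝ) (K : ℝ → ℝ → X →L[𝕜] Y) : ℝ≥0∞ :=
  ⨆ (s : ℝ) (h : ℝ) (_ : s < 0) (_ : 0 < h),
    ENNReal.ofReal h ^ (1 - 1 / r) * ∑' m : ℕ, (2 : ℝ≥0∞) ^ (((m : ℝ) + 1) * (1 - 1 / r)) *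
      (∫⁻ t in {t : ℝ | t ≤ 0 ∧ 2 ^ (m + 1) * h < s - t ∧ s - t ≤ 2 ^ (m + 2) * h},
        ‖K t s - K t (s - h)‖ₑ ^ r) ^ (1 / r)

/-- `[K]_{D'_{r,-}}`. -/
def dNeg' (r : ℝ) (K : ℝ → ℝ → X →L[𝕜] Y) : ℝ≥0∞ :=
  ⨆ (t : ℝ) (h : ℝ) (_ : t < 0) (_ : 0 < h),
    ENNReal.ofReal h ^ (1 - 1 / r) * ∑' m : ℕ, (2 : ℝ≥0∞) ^ (((m : ℝ) + 1) * (1 - 1 / r)) *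
      (∫⁻ s in {s : ℝ | s ≤ 0 ∧ 2 ^ (m + 1) * h < s - t ∧ s - t ≤ 2 ^ (m + 2) * h},
        ‖K t s - K (t + h) s‖ₑ ^ r) ^ (1 / r)

/-- `[K]_{D_{r,+}}`. -/
def dPos (r : ℝ) (K : ℝ → ℝ → X →L[𝕜] Y) : ℝ≥0∞ :=
  ⨆ (s : ℝ) (h : ℝ) (_ : 0 < s) (_ : 0 < h),
    ENNReal.ofReal h ^ (1 - 1 / r) * ∑' m : ℕ, (2 : ℝ≥0∞) ^ (((m : ℝ) + 1) * (1 - 1 / r)) *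
      (∫⁻ t in {t : ℝ | 0 ≤ t ∧ 2 ^ (m + 1) * h < t - s ∧ t - s ≤ 2 ^ (m + 2) * h},
        ‖K t s - K t (s + h)‖ₑ ^ r) ^ (1 / r)

/-- `[K]_{D'_{r,+}}`. -/
def dPos' (r : ℝ) (K : ℝ → ℝ → X →L[𝕜] Y) : ℝ≥0∞ :=
  ⨆ (t : ℝ) (h : ℝ) (_ : 0 < t) (_ : 0 < h),
    ENNReal.ofReal h ^ (1 - 1 / r) * ∑' m : ℕ, (2 : ℝ≥0∞) ^ (((m : ℝ) + 1) * (1 - 1 / r)) *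
      (∫⁻ s in {s : ℝ | 0 ≤ s ∧ 2 ^ (m + 1) * h < t - s ∧ t - s ≤ 2 ^ (m + 2) * h},
        ‖K t s - K (t - h) s‖ₑ ^ r) ^ (1 / r)

/-- The Coifman type inequality on `I` with maximal operator `M`, exponents `p` and `r`, weight `w`
and constant `C`: for every `f ∈ L_c^∞(I; X)` with `M(|Tf|) ∈ L^p_w(I)`,
`∫_I |Tf|^p w ≤ C ∫_I (M(|f|^{r'}))^{p/r'} w`. -/
def CoifmanInequality (I : Set ℝ) (M : (ℝ → ℝ≥0∞) → ℝ → ℝ≥0∞) {p₀ : ℝ≥0∞} [Fact (1 ≤ p₀)]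
    (T : Lp X p₀ (volume.restrict I) →L[𝕜] Lp Y p₀ (volume.restrict I))
    (r p : ℝ) (w : ℝ → ℝ≥0) (C : ℝ≥0) : Prop :=
  ∀ (f : ℝ → X) (hf : IsLInftyC I f),
    (∫⁻ t in I, M (fun s => ‖T ((hf.memLp p₀).toLp f) s‖ₑ) t ^ p * w t) < ∞ →
    (∫⁻ t in I, ‖T ((hf.memLp p₀).toLp f) t‖ₑ ^ p * w t) ≤
      C * ∫⁻ t in I, M (fun s => ‖f s‖ₑ ^ r.conjExponent) t ^ (p / r.conjExponent) * w t

end Operators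

end

/-! The core is a good `λ` inequality on `(-∞, 0]`; part (B) is its image under `t ↦ -t`. Put `N =
M⁺(|Tf|^{1/2})` and `Φ = M⁺(|f|^{r'})`. The square root appears because near the diagonal only the
weak type `(1, 1)` bound for `T` is used (Calderón–Zygmund decomposition with the `L^{p₀}` bound and
`D_{1,-}`, `mul_volume_lt_enorm_le`); Kolmogorov's inequality turns it into bounds for local
integrals of `|Tf|^{1/2}`. Nothing is lost: `|Tf|^p ≤ N^{2p}` a.e., while `N² ≤ M⁺(|Tf|)`, so the
assumed finiteness gives `∫ N^{2p} w < ∞` and permits absorption.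

Local estimate (`volume_good_lambda_le`). Let `N(b) ≤ l`, let `ξ < b` satisfy `Φ(ξ) ≤ (γl)^{2r'}`,
and let `L ≥ (b - ξ)/2`. Split `f` at `ξ` and at `b + 4L`. The piece left of `ξ` does not influence
`Tf` on `(ξ, b)`, as the kernel lives on `t < s`. The middle piece has `L¹` norm `O((γl)² L)`, so it
contributes a small average. For the far piece, Hölder on dyadic annuli and `D'_{r,-}` show that
`Tf₂(t)` and `Tf₂(t')` differ by `O((γl)²)` for `t ∈ (ξ, b)` and `t' ∈ (b, b + L)`; averaging over
`t'` and using `N(b) ≤ l` gives `|Tf₂|^{1/2} ≤ l + O(γl)` on `(ξ, b)`. The leading coefficient is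
exactly `1`, so the level has to rise only from `l` to `(1 + η)l`, with `η` as small as desired.

The weight enters only through `HalfMass k`, a one-sided mass comparison that holds for `A_∞⁺`
weights and, with `k` depending only on `p` and a bound for the constant, for `A_p⁺` weights.
Halving a component of `{N > l}` repeatedly towards its right end converts the local estimate into
`w(E) ≤ k/(1+k) · w{N > l}` for `E = {N > (1+η)l, Φ^{1/(2r')} ≤ γl}`. The factor `k/(1+k)` is not
small, but `η` can be chosen with `(1+η)^{2p} < (1+k)/k`, which suffices for integration in `l`
(`lintegral_rpow_le_of_good_lambda`). The resulting constant depends on `w` only through `k`, hence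
the uniformity in 2. -/

noncomputable section

/-! ### Open subsets of the line and the one-sided maximal operator -/

/-- A bounded open subset of the line is a disjoint union of countably many open intervals whose
end points lie outside the set. -/
theorem IsOpen.exists_disjoint_iUnion_Ioo {O : Set ℝ} (hO : IsOpen O) {m M : ℝ}
    (hb : O ⊆ Ioo m M) :
    ∃ a b : ℕ → ℝ, (∀ n, a n ≤ b n) ∧ (∀ n, a n ∉ O) ∧ (∀ n, b n ∉ O) ∧
      Pairwise (fun i j => Disjoint (Ioo (a i) (b i)) (Ioo (a j) (b j))) ∧
      (⋃ n, Ioo (a n) (b n)) = O := by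
  classical
  have key : ∀ x ∈ O, ∃ a b, a ∉ O ∧ b ∉ O ∧ Ioo a b ⊆ O ∧ x ∈ Ioo a b := by
    intro x hx
    have hne1 : (Oᶜ ∩ Iic x).Nonempty := ⟨m, fun h => lt_irrefl _ (hb h).1, (hb hx).1.le⟩
    have hne2 : (Oᶜ ∩ Ici x).Nonempty := ⟨M, fun h => lt_irrefl _ (hb h).2, (hb hx).2.le⟩
    have hc1 := (hO.isClosed_compl.inter isClosed_Iic).csSup_mem hne1 ⟨x, fun y hy => hy.2⟩
    have hc2 := (hO.isClosed_compl.inter isClosed_Ici).csInf_mem hne2 ⟨x, fun y hy => hy.2⟩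
    have hlt1 : sSup (Oᶜ ∩ Iic x) < x := lt_of_le_of_ne hc1.2 fun h => hc1.1 (by rw [h]; exact hx)
    have hlt2 : x < sInf (Oᶜ ∩ Ici x) := lt_of_le_of_ne hc2.2 fun h => hc2.1 (by rw [← h]; exact hx)
    refine ⟨sSup (Oᶜ ∩ Iic x), sInf (Oᶜ ∩ Ici x), hc1.1, hc2.1, fun y hy => ?_, hlt1, hlt2⟩
    by_contra hyO
    rcases le_total y x with h | h
    · exact absurd (le_csSup ⟨x, fun z hz => hz.2⟩ (show y ∈ Oᶜ ∩ Iic x from ⟨hyO, h⟩))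
        (not_le.2 hy.1)
    · exact absurd (csInf_le ⟨x, fun z hz => hz.2⟩ (show y ∈ Oᶜ ∩ Ici x from ⟨hyO, h⟩))
        (not_le.2 hy.2)
  let P : Set (ℝ × ℝ) := {p | p.1 < p.2 ∧ p.1 ∉ O ∧ p.2 ∉ O ∧ Ioo p.1 p.2 ⊆ O}
  have hdisj : P.PairwiseDisjoint fun p => Ioo p.1 p.2 := by
    intro p hp q hq hpq
    refine Set.disjoint_left.2 fun x hxp hxq => hpq ?_
    have h1 : p.1 = q.1 := by
      refine le_antisymm ?_ ?_ <;> by_contra! h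
      · exact hp.2.1 (hq.2.2.2 ⟨h, hxp.1.trans hxq.2⟩)
      · exact hq.2.1 (hp.2.2.2 ⟨h, hxq.1.trans hxp.2⟩)
    have h2 : p.2 = q.2 := by
      refine le_antisymm ?_ ?_ <;> by_contra! h
      · exact hq.2.2.1 (hp.2.2.2 ⟨hxp.1.trans hxq.2, h⟩)
      · exact hp.2.2.1 (hq.2.2.2 ⟨hxq.1.trans hxp.2, h⟩)
    exact Prod.ext h1 h2
  have hcount : P.Countable := hdisj.countable_of_isOpen (fun p _ => isOpen_Ioo)
    fun p hp => nonempty_Ioo.2 hp.1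
  have : Encodable P := hcount.toEncodable
  have hm : m ∉ O := fun h => lt_irrefl _ (hb h).1
  -- Unused indices receive the empty interval `(m, m)`, whose end point lies outside `O`. With
  -- `decode₂` no component is listed twice, as disjointness requires.
  let c : ℕ → ℝ × ℝ := fun n => ((Encodable.decode₂ P n).map Subtype.val).getD (m, m)
  have hc : ∀ n, (∃ p : P, Encodable.decode₂ P n = some p ∧ c n = p) ∨ c n = (m, m) := by
    intro n
    rcases h : Encodable.decode₂ P n with _ | p
    · right; simp [c, h]
    · left; exact ⟨p, rfl, by simp [c, h]⟩
  refine ⟨fun n => (c n).1, fun n => (c n).2, fun n => ?_, fun n => ?_, fun n => ?_, ?_, ?_⟩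
  · rcases hc n with ⟨p, -, h⟩ | h <;> simp only [h]
    exacts [p.2.1.le, le_rfl]
  · rcases hc n with ⟨p, -, h⟩ | h <;> simp only [h]
    exacts [p.2.2.1, hm]
  · rcases hc n with ⟨p, -, h⟩ | h <;> simp only [h]
    exacts [p.2.2.2.1, hm]
  · intro i j hij
    rcases hc i with ⟨p, hp, h⟩ | h
    · rcases hc j with ⟨q, hq, h'⟩ | h'
      · simp only [h, h']
        refine hdisj p.2 q.2 fun hpq => hij ?_
        rw [Encodable.decode₂_eq_some] at hp hq
        rw [← hp, ← hq, Subtype.ext hpq]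
      · simp [h']
    · simp [h]
  · refine Subset.antisymm (iUnion_subset fun n => ?_) fun x hx => ?_
    · rcases hc n with ⟨p, -, h⟩ | h
      · simp only [h]; exact p.2.2.2.2
      · simp [h]
    · obtain ⟨a, b, ha, hb', hab, hx'⟩ := key x hx
      let p : P := ⟨(a, b), hx'.1.trans hx'.2, ha, hb', hab⟩
      refine mem_iUnion.2 ⟨Encodable.encode p, ?_⟩
      have : c (Encodable.encode p) = (a, b) := by simp [c, p]
      simp only [this]; exact hx'

theorem lt_maxFwd_iff {g : ℝ → ℝ≥0∞} {l : ℝ≥0} {t : ℝ} :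
    (l : ℝ≥0∞) < maxFwd g t ↔
      ∃ h > 0, (l : ℝ≥0∞) * ENNReal.ofReal h < ∫⁻ s in Ioc t (t + h), g s := by
  simp only [maxFwd, lt_iSup_iff, exists_prop]
  refine exists_congr fun h => and_congr_right fun hh => ?_
  rw [ENNReal.lt_div_iff_mul_lt (Or.inl (by simpa using hh)) (Or.inl ENNReal.ofReal_ne_top)]

theorem maxFwd_le_iff {g : ℝ → ℝ≥0∞} {l : ℝ≥0∞} {t : ℝ} :
    maxFwd g t ≤ l ↔ ∀ h > 0, ∫⁻ s in Ioc t (t + h), g s ≤ l * ENNReal.ofReal h := by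
  simp only [maxFwd, iSup_le_iff]
  refine forall₂_congr fun h hh => ?_
  rw [ENNReal.div_le_iff (by simpa using hh) ENNReal.ofReal_ne_top]

/-- Keep the right end `t + h` of a good interval and move the left end. Continuity from below of
the measure with density `g` leaves room to the right of `t`; neither measurability nor
integrability of `g` is needed. -/
theorem isOpen_lt_maxFwd (g : ℝ → ℝ≥0∞) (l : ℝ≥0) : IsOpen {t | (l : ℝ≥0∞) < maxFwd g t} := by
  refine isOpen_iff_mem_nhds.2 fun t ht => ?_
  obtain ⟨h, hh, hlt⟩ := lt_maxFwd_iff.1 ht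
  set μ := volume.withDensity g
  have hμ : ∀ a b, ∫⁻ s in Ioc a b, g s = μ (Ioc a b) := fun a b =>
    (withDensity_apply g measurableSet_Ioc).symm
  rw [hμ] at hlt
  have hmono : Filter.Tendsto (fun n : ℕ => μ (Ioc (t + h * (1 / ((n : ℝ) + 1))) (t + h)))
      Filter.atTop (𝓝 (μ (⋃ n : ℕ, Ioc (t + h * (1 / ((n : ℝ) + 1))) (t + h)))) := by
    refine tendsto_measure_iUnion_atTop fun i j hij => Ioc_subset_Ioc_left ?_
    have : 1 / ((j : ℝ) + 1) ≤ 1 / ((i : ℝ) + 1) := Nat.one_div_le_one_div hij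
    nlinarith
  have hU : (⋃ n : ℕ, Ioc (t + h * (1 / ((n : ℝ) + 1))) (t + h)) = Ioc t (t + h) := by
    refine Subset.antisymm (iUnion_subset fun n => Ioc_subset_Ioc_left ?_) fun x hx => ?_
    · have : 0 < h * (1 / ((n : ℝ) + 1)) := by positivity
      linarith
    · obtain ⟨n, hn⟩ := exists_nat_one_div_lt (div_pos (sub_pos.2 hx.1) hh)
      refine mem_iUnion.2 ⟨n, ?_, hx.2⟩
      rw [lt_div_iff₀ hh] at hn
      nlinarith
  rw [hU] at hmono
  obtain ⟨n, hn⟩ := (hmono.eventually (lt_mem_nhds hlt)).exists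
  have hnpos : 0 < h * (1 / ((n : ℝ) + 1)) := by positivity
  have hcont : Filter.Tendsto (fun x : ℝ => (l : ℝ≥0∞) * ENNReal.ofReal (t + h - x)) (𝓝 t)
      (𝓝 ((l : ℝ≥0∞) * ENNReal.ofReal h)) := by
    have h2 : Filter.Tendsto (fun x : ℝ => ENNReal.ofReal (t + h - x)) (𝓝 t)
        (𝓝 (ENNReal.ofReal h)) := by
      refine ENNReal.tendsto_ofReal ?_
      have : ContinuousAt (fun x : ℝ => t + h - x) t := by fun_prop
      simpa [ContinuousAt] using this
    exact ENNReal.Tendsto.const_mul h2 (Or.inr ENNReal.coe_ne_top)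
  filter_upwards [hcont.eventually (gt_mem_nhds hn),
    gt_mem_nhds (show t < t + h * (1 / ((n : ℝ) + 1)) by linarith),
    gt_mem_nhds (show t < t + h by linarith)] with x hx1 hx2 hx3
  refine lt_maxFwd_iff.2 ⟨t + h - x, by linarith, hx1.trans_le ?_⟩
  rw [hμ]
  exact measure_mono (Ioc_subset_Ioc hx2.le (by linarith))

theorem measurable_maxFwd (g : ℝ → ℝ≥0∞) : Measurable (maxFwd g) := by
  have h : LowerSemicontinuous (maxFwd g) := by
    intro t y hy
    obtain ⟨l, hl, hlt⟩ := ENNReal.lt_iff_exists_nnreal_btwn.1 hy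
    filter_upwards [(isOpen_lt_maxFwd g l).mem_nhds hlt] with x hx using hl.trans hx
  exact h.measurable

theorem isClosed_maxFwd_le (g : ℝ → ℝ≥0∞) (l : ℝ≥0) : IsClosed {t | maxFwd g t ≤ l} := by
  have : {t | maxFwd g t ≤ l} = {t | (l : ℝ≥0∞) < maxFwd g t}ᶜ := by ext; simp
  rw [this]; exact (isOpen_lt_maxFwd g l).isClosed_compl

theorem maxFwd_eq_zero {g : ℝ → ℝ≥0∞} {c : ℝ} (hg : ∀ s, c < s → g s = 0) {t : ℝ} (ht : c ≤ t) :
    maxFwd g t = 0 := by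
  rw [← nonpos_iff_eq_zero, maxFwd_le_iff]
  intro h hh
  rw [zero_mul, nonpos_iff_eq_zero, setLIntegral_congr_fun measurableSet_Ioc
    (g := 0) fun s hs => hg s (ht.trans_lt hs.1)]
  simp

/-- The rising sun lemma. -/
theorem mul_le_lintegral_of_subset_lt_maxFwd {g : ℝ → ℝ≥0∞} {l : ℝ≥0} {a b t : ℝ}
    (hab : Ioo a b ⊆ {t | (l : ℝ≥0∞) < maxFwd g t}) (hb : maxFwd g b ≤ l) (ht : t ∈ Ioo a b) :
    l * ENNReal.ofReal (b - t) ≤ ∫⁻ s in Ioc t b, g s := by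
  set μ := volume.withDensity g
  have hμ : ∀ a b, ∫⁻ s in Ioc a b, g s = μ (Ioc a b) := fun a b =>
    (withDensity_apply g measurableSet_Ioc).symm
  have hadd : ∀ x y z, x ≤ y → y ≤ z → μ (Ioc x z) = μ (Ioc x y) + μ (Ioc y z) := by
    intro x y z hxy hyz
    rw [← Ioc_union_Ioc_eq_Ioc hxy hyz, measure_union _ measurableSet_Ioc]
    exact Set.disjoint_left.2 fun u hu hu' => absurd hu.2 (not_le.2 hu'.1)
  have hl : ∀ x y, x ≤ y → ∀ z, y ≤ z → (l : ℝ≥0∞) * ENNReal.ofReal (z - x) =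
      l * ENNReal.ofReal (y - x) + l * ENNReal.ofReal (z - y) := by
    intro x y hxy z hyz
    rw [← mul_add, ← ENNReal.ofReal_add (by linarith) (by linarith)]
    congr 2; ring
  rw [hμ]
  -- The claim is `b ∈ S`. If `s = sup S < b`, then `s` has an interval to its right with mean above
  -- `l`, which can be appended to `(t, s]`; a part protruding beyond `b` is discarded by means of
  -- `maxFwd g b ≤ l`.
  let S : Set ℝ := {x | x ∈ Icc t b ∧ (l : ℝ≥0∞) * ENNReal.ofReal (x - t) ≤ μ (Ioc t x)}
  have hbdd : BddAbove S := ⟨b, fun x hx => hx.1.2⟩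
  have htS : t ∈ S := ⟨⟨le_rfl, ht.2.le⟩, by simp⟩
  set s := sSup S
  have hts : t ≤ s := le_csSup hbdd htS
  have hsb : s ≤ b := csSup_le ⟨t, htS⟩ fun x hx => hx.1.2
  have hsS : s ∈ S := by
    refine ⟨⟨hts, hsb⟩, ?_⟩
    have hcl : s ∈ closure S := csSup_mem_closure ⟨t, htS⟩ hbdd
    have hclosed : IsClosed {x : ℝ | (l : ℝ≥0∞) * ENNReal.ofReal (x - t) ≤ μ (Ioc t s)} :=
      isClosed_le ((ENNReal.continuous_const_mul ENNReal.coe_ne_top).comp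
        (ENNReal.continuous_ofReal.comp (by fun_prop))) continuous_const
    exact closure_minimal (fun x hx => hx.2.trans (measure_mono
      (Ioc_subset_Ioc_right (le_csSup hbdd hx)))) hclosed hcl
  rcases hsb.eq_or_lt with h | h
  · simpa [h] using hsS.2
  exfalso
  obtain ⟨h', hh', hlt⟩ := lt_maxFwd_iff.1 (hab ⟨ht.1.trans_le hts, h⟩)
  rw [hμ] at hlt
  rcases le_total (s + h') b with hc | hc
  · have : s + h' ∈ S := by
      refine ⟨⟨by linarith, hc⟩, ?_⟩
      rw [hadd t s _ hts (by linarith), hl t s hts _ (by linarith)]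
      refine add_le_add hsS.2 ?_
      simpa using hlt.le
    linarith [le_csSup hbdd this]
  · have h1 : μ (Ioc b (s + h')) ≤ l * ENNReal.ofReal (s + h' - b) := by
      rcases hc.eq_or_lt with h2 | h2
      · simp [h2]
      · have := maxFwd_le_iff.1 hb (s + h' - b) (by linarith)
        rw [hμ] at this
        simpa using this
    rw [hadd s b _ h.le hc, show h' = s + h' - s by ring, hl s b h.le _ (by linarith),
      show s + (s + h' - s) = s + h' by ring] at hlt
    have h3 : (l : ℝ≥0∞) * ENNReal.ofReal (b - s) ≤ μ (Ioc s b) := by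
      by_contra! h4
      exact absurd hlt (not_lt.2 (add_le_add h4.le h1))
    have : b ∈ S := by
      refine ⟨⟨ht.2.le, le_rfl⟩, ?_⟩
      rw [hadd t s _ hts hsb, hl t s hts _ hsb]
      exact add_le_add hsS.2 h3
    linarith [le_csSup hbdd this]

/-- The weak type `(1, 1)` inequality for the one-sided maximal operator. -/
theorem mul_volume_lt_maxFwd_le {g : ℝ → ℝ≥0∞} {c : ℝ} (hg : ∀ s, c < s → g s = 0) (l : ℝ≥0) :
    l * volume {t | (l : ℝ≥0∞) < maxFwd g t} ≤ ∫⁻ s, g s := by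
  set O := {t | (l : ℝ≥0∞) < maxFwd g t}
  have hOc : O ⊆ Iio c := by
    intro t ht
    by_contra h
    have : (l : ℝ≥0∞) < maxFwd g t := ht
    rw [maxFwd_eq_zero hg (not_lt.1 h)] at this
    exact not_lt_zero this
  -- Truncation makes the set bounded. A left end may now be `m ∈ O`, but right ends of nonempty
  -- components stay outside `O`, which is all that the rising sun lemma uses.
  have key : ∀ m : ℝ, l * volume (O ∩ Ioi m) ≤ ∫⁻ s, g s := by
    intro m
    obtain ⟨a, b, hab, ha, hb, hd, hU⟩ := ((isOpen_lt_maxFwd g l).inter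
      isOpen_Ioi).exists_disjoint_iUnion_Ioo (O := O ∩ Ioi m) (m := m) (M := c)
      fun x hx => ⟨hx.2, hOc hx.1⟩
    have h1 : ∀ n, (l : ℝ≥0∞) * volume (Ioo (a n) (b n)) ≤ ∫⁻ s in Ioo (a n) (b n), g s := by
      intro n
      rcases (hab n).eq_or_lt with h | h
      · simp [h]
      have hsub : Ioo (a n) (b n) ⊆ O ∩ Ioi m := hU ▸ subset_iUnion (fun n => Ioo (a n) (b n)) n
      have hbn : maxFwd g (b n) ≤ l := by
        by_contra! h'
        obtain ⟨x, hx⟩ := nonempty_Ioo.2 h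
        exact hb n ⟨h', lt_trans (hsub hx).2 hx.2⟩
      rw [Real.volume_Ioo]
      have hlim : Filter.Tendsto (fun t => (l : ℝ≥0∞) * ENNReal.ofReal (b n - t)) (𝓝[>] a n)
          (𝓝 (l * ENNReal.ofReal (b n - a n))) := by
        refine Filter.Tendsto.mono_left ?_ nhdsWithin_le_nhds
        exact ((ENNReal.continuous_const_mul ENNReal.coe_ne_top).comp
          (ENNReal.continuous_ofReal.comp (by fun_prop))).tendsto _
      refine le_of_tendsto hlim ?_
      filter_upwards [Ioo_mem_nhdsGT h] with t ht
      refine (mul_le_lintegral_of_subset_lt_maxFwd (hsub.trans inter_subset_left) hbn ht).trans ?_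
      rw [← restrict_Ioo_eq_restrict_Ioc]
      exact lintegral_mono_set (Ioo_subset_Ioo_left ht.1.le)
    rw [← hU, measure_iUnion hd fun _ => measurableSet_Ioo, ← ENNReal.tsum_mul_left]
    refine (ENNReal.tsum_le_tsum h1).trans ?_
    rw [← lintegral_iUnion (fun _ => measurableSet_Ioo) hd]
    exact setLIntegral_le_lintegral _ _
  have hUn : O = ⋃ n : ℕ, O ∩ Ioi (-(n : ℝ)) := by
    rw [← inter_iUnion]
    refine (inter_eq_left.2 fun x _ => ?_).symm
    obtain ⟨n, hn⟩ := exists_nat_gt (-x)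
    exact mem_iUnion.2 ⟨n, by simp only [mem_Ioi]; linarith⟩
  have hlim : Filter.Tendsto (fun n : ℕ => (l : ℝ≥0∞) * volume (O ∩ Ioi (-(n : ℝ)))) Filter.atTop
      (𝓝 (l * volume O)) := by
    refine ENNReal.Tendsto.const_mul ?_ (Or.inr ENNReal.coe_ne_top)
    conv => enter [3, 1, 2]; rw [hUn]
    refine tendsto_measure_iUnion_atTop fun i j hij => ?_
    have : (i : ℝ) ≤ j := by exact_mod_cast hij
    exact inter_subset_inter_right _ (Ioi_subset_Ioi (by linarith))
  exact le_of_tendsto hlim (Filter.Eventually.of_forall fun n => key _)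

/-- Lebesgue differentiation along the one-sided intervals `[t, t + 2d]`. These are closed balls
centred at `t + d` with `t` on the boundary, admissible for the Vitali family with dilation `1`. -/
theorem ae_le_maxFwd {g : ℝ → ℝ≥0∞} (hg : AEMeasurable g)
    (hint : ∀ R : ℝ, ∫⁻ s in Ioo (-R) R, g s ≠ ∞) : ∀ᵐ t, g t ≤ maxFwd g t := by
  have key : ∀ n : ℕ, ∀ᵐ t, t ∈ Ioo (-(n : ℝ)) n → g t ≤ maxFwd g t := by
    intro n
    have h1 := (IsUnifLocDoublingMeasure.vitaliFamily (volume : Measure ℝ) 1).ae_tendsto_lintegral_div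
      (f := (Ioo (-(n : ℝ)) n).indicator g) (hg.indicator measurableSet_Ioo)
      (by rw [lintegral_indicator measurableSet_Ioo]; exact hint n)
    filter_upwards [h1] with t ht htn
    have hδ : Filter.Tendsto (fun k : ℕ => 1 / ((k : ℝ) + 1)) Filter.atTop (𝓝[>] 0) :=
      tendsto_nhdsWithin_iff.2 ⟨tendsto_one_div_add_atTop_nhds_zero_nat,
        Filter.Eventually.of_forall fun k => by simp only [mem_Ioi]; positivity⟩
    have h2 := IsUnifLocDoublingMeasure.tendsto_closedBall_filterAt (volume : Measure ℝ) (K := 1)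
      (x := t) (fun k : ℕ => t + 1 / ((k : ℝ) + 1)) (fun k : ℕ => 1 / ((k : ℝ) + 1)) hδ
      (Filter.Eventually.of_forall fun k => by
        rw [Metric.mem_closedBall, dist_self_add_right, Real.norm_of_nonneg (by positivity), one_mul])
    have h3 := ht.comp h2
    rw [indicator_of_mem htn] at h3
    refine le_of_tendsto h3 (Filter.Eventually.of_forall fun k => ?_)
    set d := 1 / ((k : ℝ) + 1)
    have hd : 0 < d := by positivity
    simp only [Function.comp, Real.closedBall_eq_Icc]
    refine ENNReal.div_le_of_le_mul ?_
    rw [← restrict_Ioc_eq_restrict_Icc]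
    refine le_trans (lintegral_mono fun s => indicator_le_self' (by simp) s) ?_
    have := maxFwd_le_iff.1 (le_refl (maxFwd g t)) (2 * d) (by positivity)
    change ∫⁻ s in Ioc (t + d - d) (t + d + d), g s ≤
      maxFwd g t * volume (Icc (t + d - d) (t + d + d))
    rwa [Real.volume_Icc, show t + d - d = t by ring, show t + d + d = t + 2 * d by ring,
      add_sub_cancel_left]
  filter_upwards [ae_all_iff.2 key] with t ht
  obtain ⟨n, hn⟩ := exists_nat_gt |t|
  exact ht n (abs_lt.1 hn)

/-- Cauchy–Schwarz on `(t, t + h]`. It transfers the finiteness assumption from `M⁺(|Tf|)` to `N`.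
-/
theorem sq_maxFwd_rpow_half_le {g : ℝ → ℝ≥0∞} (hg : AEMeasurable g) (t : ℝ) :
    maxFwd (fun s => g s ^ (1 / 2 : ℝ)) t ^ (2 : ℝ) ≤ maxFwd g t := by
  rw [show (2 : ℝ) = (1 / 2 : ℝ)⁻¹ by norm_num, ENNReal.rpow_inv_le_iff (by norm_num),
    maxFwd_le_iff]
  intro h hh
  have h1 := ENNReal.lintegral_mul_le_Lp_mul_Lq (volume.restrict (Ioc t (t + h)))
    Real.HolderConjugate.two_two (hg.restrict.pow_const (1 / 2 : ℝ)) (aemeasurable_const (b := 1))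
  simp only [Pi.mul_apply, mul_one, ENNReal.one_rpow, lintegral_const, one_mul,
    Measure.restrict_apply MeasurableSet.univ, univ_inter, Real.volume_Ioc, ← ENNReal.rpow_mul] at h1
  norm_num at h1
  norm_num
  refine h1.trans ?_
  have h2 := maxFwd_le_iff.1 (le_refl (maxFwd g t)) h hh
  calc (∫⁻ s in Ioc t (t + h), g s) ^ (1 / 2 : ℝ) * ENNReal.ofReal h ^ (1 / 2 : ℝ)
      ≤ (maxFwd g t * ENNReal.ofReal h) ^ (1 / 2 : ℝ) * ENNReal.ofReal h ^ (1 / 2 : ℝ) := by gcongr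
    _ = _ := by
      rw [ENNReal.mul_rpow_of_nonneg _ _ (by norm_num), mul_assoc,
        ← ENNReal.rpow_add _ _ (by simpa using hh) ENNReal.ofReal_ne_top]
      norm_num

/-! ### One-sided mass comparison for weights -/

/-- A subset of the right part `[b, c]` of `[a, c]` filling at least half of it has at least
`1 / k` times the mass of the left part, when `c - b` is half of `b - a`. -/
def HalfMass (k : ℝ≥0) (μ : Measure ℝ) : Prop :=
  ∀ a b c : ℝ, a < b → b < c → c ≤ 0 → c - b = (b - a) / 2 → ∀ S : Set ℝ, MeasurableSet S →
    S ⊆ Icc b c → ENNReal.ofReal ((c - b) / 2) ≤ volume S → μ (Ioo a b) ≤ k * μ S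

/-- The measure on `(-∞, 0]` with density `w`. -/
def negMeasure (w : ℝ → ℝ≥0) : Measure ℝ :=
  (volume.restrict (Iic 0)).withDensity fun t => (w t : ℝ≥0∞)

theorem negMeasure_absolutelyContinuous (w : ℝ → ℝ≥0) : negMeasure w ≪ volume :=
  (withDensity_absolutelyContinuous _ _).trans Measure.restrict_le_self.absolutelyContinuous

instance (w : ℝ → ℝ≥0) : NullSingletonClass (negMeasure w) :=
  ⟨fun x => negMeasure_absolutelyContinuous w (measure_singleton x)⟩

theorem negMeasure_apply (w : ℝ → ℝ≥0) {S : Set ℝ} (hS : MeasurableSet S) (h : S ⊆ Iic 0) :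
    negMeasure w S = wMass w S := by
  rw [negMeasure, withDensity_apply _ hS, wMass, Measure.restrict_restrict hS,
    inter_eq_left.2 h]

theorem lintegral_negMeasure {w : ℝ → ℝ≥0} (hw : AEMeasurable w (volume.restrict (Iic 0)))
    {g : ℝ → ℝ≥0∞} (hg : AEMeasurable g (volume.restrict (Iic 0))) :
    ∫⁻ t, g t ∂negMeasure w = ∫⁻ t in Iic 0, g t * w t := by
  rw [negMeasure, lintegral_withDensity_eq_lintegral_mul₀ hw.coe_nnreal_ennreal hg]
  simp only [Pi.mul_apply, mul_comm]

/-- As `c - b = (b - a)/2`, half of `[b, c]` is a sixth of `[a, c]`. Hence `1/6 ≤ C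
(w(S)/w(a,b))^δ`, and `k = (6C)^{1/δ}` works. -/
theorem AInftyFwdNeg.exists_halfMass {w : ℝ → ℝ≥0} (hw : AInftyFwdNeg w) :
    ∃ k : ℝ≥0, HalfMass k (negMeasure w) := by
  obtain ⟨-, C, hC, δ, hδ, h⟩ := hw
  set x : ℝ≥0 := (Real.toNNReal (6 * C))⁻¹ ^ (1 / δ) with hx
  have hx0 : x ≠ 0 := by
    rw [hx, Ne, NNReal.rpow_eq_zero (by positivity)]
    simp only [inv_eq_zero, Real.toNNReal_eq_zero, not_le]
    positivity
  refine ⟨x⁻¹, fun a b c hab hbc hc0 hcb S hS hSbc hvol => ?_⟩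
  rw [negMeasure_apply w measurableSet_Ioo fun t ht => (ht.2.trans (hbc.trans_le hc0)).le,
    negMeasure_apply w hS fun t ht => (hSbc ht).2.trans hc0]
  have h1 := h a b c hab hbc hc0 S hS hSbc
  have h2 : ENNReal.ofReal (1 / 6) ≤ volume S / ENNReal.ofReal (c - a) := by
    rw [ENNReal.le_div_iff_mul_le (Or.inl (by simp; linarith)) (Or.inl ENNReal.ofReal_ne_top),
      ← ENNReal.ofReal_mul (by norm_num)]
    convert hvol using 2
    linarith
  have h3 : (x : ℝ≥0∞) ≤ wMass w S / wMass w (Ioo a b) := by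
    rw [hx, ENNReal.coe_rpow_of_nonneg _ (by positivity), one_div,
      ENNReal.rpow_inv_le_iff hδ, ENNReal.coe_inv (by simp; positivity)]
    change (ENNReal.ofReal (6 * C))⁻¹ ≤ _
    rw [← ENNReal.ofReal_inv_of_pos (by positivity)]
    have h4 := mul_le_mul_right (h2.trans h1) (ENNReal.ofReal C⁻¹)
    rw [← mul_assoc, ← ENNReal.ofReal_mul (by positivity), ← ENNReal.ofReal_mul (by positivity),
      inv_mul_cancel₀ hC.ne', ENNReal.ofReal_one, one_mul] at h4
    rwa [show (6 * C)⁻¹ = C⁻¹ * (1 / 6) by rw [mul_inv]; ring]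
  have h5 := ENNReal.mul_le_of_le_div h3
  rw [ENNReal.coe_inv hx0]
  calc wMass w (Ioo a b) = (x : ℝ≥0∞)⁻¹ * (x * wMass w (Ioo a b)) := by
        rw [← mul_assoc, ENNReal.inv_mul_cancel (by simpa using hx0) ENNReal.coe_ne_top, one_mul]
    _ ≤ _ := by gcongr

/-- Hölder applied to `1 = w^{1/p} w^{-1/p}` on `S` gives `|S|^p ≤ w(S) (∫_b^c w^{1-p'})^{p-1}`.
Multiplying by `w(a,b)` and using the `A_p⁺` bound and `|S| ≥ (c - a)/6` yields a constant depending
only on `p` and `M`. -/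
theorem ApFwdNeg.halfMass {p : ℝ} (hp : 1 < p) {w : ℝ → ℝ≥0} (hw : ApFwdNeg p w) {M : ℝ≥0}
    (hM : apFwdNegConst p w ≤ M) : HalfMass (6 ^ p * M) (negMeasure w) := by
  intro a b c hab hbc hc0 hcb S hS hSbc hvol
  have hpq : p.HolderConjugate p.conjExponent := Real.HolderConjugate.conjExponent hp
  have hSI : S ⊆ Iic 0 := fun t ht => (hSbc ht).2.trans hc0
  rw [negMeasure_apply w measurableSet_Ioo fun t ht => (ht.2.trans (hbc.trans_le hc0)).le,
    negMeasure_apply w hS hSI]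
  set B := ∫⁻ t in Ioc b c, (w t : ℝ≥0∞) ^ (1 - p.conjExponent)
  have hA : wMass w (Ioo a b) * B ^ (p - 1) ≤ M * ENNReal.ofReal (c - a) ^ p := by
    have h0 : wMass w (Ioc a b) * B ^ (p - 1) / ENNReal.ofReal (c - a) ^ p ≤ M := by
      refine le_trans ?_ hM
      unfold apFwdNegConst
      exact le_iSup_of_le a <| le_iSup_of_le b <| le_iSup_of_le c <| le_iSup_of_le hab <|
        le_iSup_of_le hbc <| le_iSup_of_le hc0 le_rfl
    have hca : 0 < ENNReal.ofReal (c - a) ^ p :=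
      ENNReal.rpow_pos (by simp; linarith) ENNReal.ofReal_ne_top
    rw [ENNReal.div_le_iff hca.ne' (ENNReal.rpow_ne_top_of_nonneg (by linarith)
      ENNReal.ofReal_ne_top)] at h0
    refine le_trans ?_ h0
    gcongr
    exact lintegral_mono_set Ioo_subset_Ioc_self
  have hwm : AEMeasurable (fun t => (w t : ℝ≥0∞)) (volume.restrict S) :=
    (hw.1.aemeasurable.mono_measure (Measure.restrict_mono hSI le_rfl)).coe_nnreal_ennreal
  have hwpos : ∀ᵐ t ∂volume.restrict S, 0 < w t :=
    ae_mono (Measure.restrict_mono hSI le_rfl) hw.1.pos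
  have hH : volume S ^ p ≤ wMass w S * B ^ (p - 1) := by
    have h1 := ENNReal.lintegral_mul_le_Lp_mul_Lq (volume.restrict S) hpq
      (hwm.pow_const (1 / p)) (hwm.pow_const (-(1 / p)))
    have h2 : ∫⁻ t in S, ((fun t => (w t : ℝ≥0∞) ^ (1 / p)) *
        fun t => (w t : ℝ≥0∞) ^ (-(1 / p))) t = volume S := by
      rw [← setLIntegral_one]
      refine lintegral_congr_ae (hwpos.mono fun t ht => ?_)
      simp only [Pi.mul_apply]
      rw [← ENNReal.rpow_add _ _ (by simpa using ht.ne') ENNReal.coe_ne_top]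
      simp
    rw [h2] at h1
    simp only [← ENNReal.rpow_mul] at h1
    have hp0 : p ≠ 0 := by linarith
    rw [show 1 / p * p = 1 by field_simp, show -(1 / p) * p.conjExponent = 1 - p.conjExponent by
      rw [Real.conjExponent]; have : p - 1 ≠ 0 := by linarith
      field_simp; ring] at h1
    simp only [ENNReal.rpow_one] at h1
    calc volume S ^ p ≤ ((∫⁻ t in S, (w t : ℝ≥0∞)) ^ (1 / p) *
          (∫⁻ t in S, (w t : ℝ≥0∞) ^ (1 - p.conjExponent)) ^ (1 / p.conjExponent)) ^ p := by
          gcongr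
      _ = wMass w S * (∫⁻ t in S, (w t : ℝ≥0∞) ^ (1 - p.conjExponent)) ^ (p - 1) := by
          rw [ENNReal.mul_rpow_of_nonneg _ _ (by linarith), ← ENNReal.rpow_mul,
            ← ENNReal.rpow_mul, show 1 / p * p = 1 by field_simp, ENNReal.rpow_one,
            show 1 / p.conjExponent * p = p - 1 by
              rw [Real.conjExponent]; have : p - 1 ≠ 0 := by linarith
              field_simp]
          rfl
      _ ≤ _ := by
          refine mul_le_mul_right (ENNReal.rpow_le_rpow ?_ (by linarith)) _
          refine (lintegral_mono_set hSbc).trans ?_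
          rw [← restrict_Ioc_eq_restrict_Icc]
  have hca0 : ENNReal.ofReal ((c - a) / 6) ^ p ≠ 0 :=
    (ENNReal.rpow_pos (by simp; linarith) ENNReal.ofReal_ne_top).ne'
  have hcat : ENNReal.ofReal ((c - a) / 6) ^ p ≠ ∞ :=
    ENNReal.rpow_ne_top_of_nonneg (by linarith) ENNReal.ofReal_ne_top
  rw [← ENNReal.mul_le_mul_iff_left hca0 hcat]
  calc wMass w (Ioo a b) * ENNReal.ofReal ((c - a) / 6) ^ p
      ≤ wMass w (Ioo a b) * volume S ^ p := by
        gcongr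
        convert hvol using 2
        linarith
    _ ≤ wMass w (Ioo a b) * (wMass w S * B ^ (p - 1)) := by gcongr
    _ = (wMass w (Ioo a b) * B ^ (p - 1)) * wMass w S := by ring
    _ ≤ (M * ENNReal.ofReal (c - a) ^ p) * wMass w S := by gcongr
    _ = _ := by
        rw [show c - a = 6 * ((c - a) / 6) by ring, ENNReal.ofReal_mul (by norm_num),
          ENNReal.mul_rpow_of_nonneg _ _ (by linarith), ENNReal.coe_mul,
          ENNReal.coe_rpow_of_nonneg _ (by linarith)]
        norm_num
        ring

/-- Cut `(a, b)` at the points `x n` that halve the distance to `b`. Each piece is twice as long as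
the next one, at least half of which lies outside `E`, so `HalfMass` charges the mass of a piece to
the part of the next piece outside `E`. These parts are disjoint and the charges add up. -/
theorem HalfMass.measure_inter_Ioo_le {k : ℝ≥0} {μ : Measure ℝ} [NullSingletonClass μ] (hμ : HalfMass k μ)
    {E : Set ℝ} (hE : MeasurableSet E) {a b : ℝ} (hab : a < b) (hb : b ≤ 0)
    (h : ∀ x ∈ Ioo a b, volume (E ∩ Ioo x ((x + b) / 2)) ≤ ENNReal.ofReal ((b - x) / 4)) :
    μ (E ∩ Ioo a b) ≤ k * μ (Ioo a b \ E) := by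
  let x : ℕ → ℝ := fun n => b - (b - a) * (1 / 2) ^ n
  have hx1 : ∀ n, x (n + 1) = (x n + b) / 2 := fun n => by simp only [x, pow_succ]; ring
  have hpos : ∀ n, 0 < (b - a) * (1 / 2 : ℝ) ^ n := fun n => by
    have := sub_pos.2 hab; positivity
  have hxb : ∀ n, x n < b := fun n => by simp only [x]; linarith [hpos n]
  have hlt : ∀ n, x n < x (n + 1) := fun n => by rw [hx1]; linarith [hxb n]
  have hmono : StrictMono x := strictMono_nat_of_lt_succ hlt
  have hx0 : x 0 = a := by simp [x]
  have hstep : ∀ n, μ (Ioc (x n) (x (n + 1))) ≤ k * μ (Ioo (x (n + 1)) (x (n + 2)) \ E) := by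
    intro n
    rw [measure_congr Ioo_ae_eq_Ioc.symm]
    refine hμ _ _ (x (n + 2)) (hlt n) (hlt _) ((hxb _).le.trans hb)
      (by rw [hx1 (n + 1), hx1 n]; ring) _
      (measurableSet_Ioo.diff hE) (sdiff_subset.trans Ioo_subset_Icc_self) ?_
    have h1 := h (x (n + 1)) ⟨hx0 ▸ hmono (Nat.succ_pos n), hxb _⟩
    rw [← hx1 (n + 1)] at h1
    have h2 : volume (Ioo (x (n + 1)) (x (n + 2))) ≤
        volume (E ∩ Ioo (x (n + 1)) (x (n + 2))) + volume (Ioo (x (n + 1)) (x (n + 2)) \ E) := by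
      rw [inter_comm]; exact measure_le_inter_add_sdiff _ _ _
    rw [Real.volume_Ioo] at h2
    -- The piece has length `(b - x (n+1))/2`, so `(b - x (n+1))/4` is half of it.
    have h3 : ENNReal.ofReal (x (n + 2) - x (n + 1)) =
        ENNReal.ofReal ((b - x (n + 1)) / 4) + ENNReal.ofReal ((x (n + 2) - x (n + 1)) / 2) := by
      rw [← ENNReal.ofReal_add (by linarith [hxb (n + 1)]) (by linarith [hlt (n + 1)]),
        hx1 (n + 1)]
      congr 1; ring
    rw [h3] at h2
    exact (ENNReal.add_le_add_iff_left ENNReal.ofReal_ne_top).1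
      (h2.trans (add_le_add h1 le_rfl))
  have hcover : Ioo a b ⊆ ⋃ n, Ioc (x n) (x (n + 1)) := by
    intro y hy
    have hlim : Filter.Tendsto x Filter.atTop (𝓝 (b - (b - a) * 0)) :=
      ((tendsto_pow_atTop_nhds_zero_of_lt_one (by norm_num) (by norm_num)).const_mul _).const_sub _
    obtain ⟨n, hn⟩ := (hlim.eventually (lt_mem_nhds (by simpa using hy.2))).exists
    classical
    have hex : ∃ n, y ≤ x n := ⟨n, hn.le⟩
    obtain ⟨m, hm⟩ : ∃ m, Nat.find hex = m + 1 := Nat.exists_eq_succ_of_ne_zero fun h0 => by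
      have := Nat.find_spec hex
      rw [h0, hx0] at this
      exact absurd hy.1 (not_lt.2 this)
    refine mem_iUnion.2 ⟨m, not_le.1 (Nat.find_min hex (hm ▸ Nat.lt_succ_self m)), ?_⟩
    rw [← hm]; exact Nat.find_spec hex
  calc μ (E ∩ Ioo a b) ≤ μ (⋃ n, Ioc (x n) (x (n + 1))) :=
        measure_mono (inter_subset_right.trans hcover)
    _ ≤ ∑' n, μ (Ioc (x n) (x (n + 1))) := measure_iUnion_le _
    _ ≤ ∑' n, k * μ (Ioo (x (n + 1)) (x (n + 2)) \ E) := ENNReal.tsum_le_tsum hstep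
    _ = k * μ (⋃ n, Ioo (x (n + 1)) (x (n + 2)) \ E) := by
        rw [ENNReal.tsum_mul_left, measure_iUnion _ fun n => measurableSet_Ioo.diff hE]
        intro i j hij
        wlog hlt' : i < j generalizing i j
        · exact (this hij.symm (lt_of_le_of_ne (not_lt.1 hlt') hij.symm)).symm
        refine Set.disjoint_left.2 fun y hy hy' => ?_
        exact absurd (hy.1.2.trans_le (hmono.monotone (by omega : i + 2 ≤ j + 1)))
          (not_lt.2 hy'.1.1.le)
    _ ≤ _ := by
        gcongr
        refine iUnion_subset fun n => sdiff_subset_sdiff_left ?_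
        exact Ioo_subset_Ioo (hx0 ▸ (hmono.monotone (Nat.zero_le _))) (hxb _).le

/-- The estimate on single intervals is summed over the components of `O ∩ (m, ∞)`, then `m → -∞`.
The truncation is harmless because the hypothesis concerns every interval `(x, b) ⊆ O` with `b ∉ O`,
not only full components. -/
theorem HalfMass.measure_inter_le {k : ℝ≥0} {μ : Measure ℝ} [NullSingletonClass μ] (hμ : HalfMass k μ)
    {E O : Set ℝ} (hE : MeasurableSet E) (hO : IsOpen O) (hO0 : O ⊆ Iio 0)
    (h : ∀ x b, x < b → b ≤ 0 → b ∉ O → Ioo x b ⊆ O →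
      volume (E ∩ Ioo x ((x + b) / 2)) ≤ ENNReal.ofReal ((b - x) / 4)) :
    (1 + k) * μ (E ∩ O) ≤ k * μ O := by
  have key : ∀ m : ℝ, μ (E ∩ (O ∩ Ioi m)) ≤ k * μ ((O ∩ Ioi m) \ E) := by
    intro m
    obtain ⟨a, b, hab, ha, hb, hd, hU⟩ := (hO.inter
      isOpen_Ioi).exists_disjoint_iUnion_Ioo (O := O ∩ Ioi m) (m := m) (M := 0)
      fun x hx => ⟨hx.2, hO0 hx.1⟩
    have h1 : ∀ n, μ (E ∩ Ioo (a n) (b n)) ≤ k * μ (Ioo (a n) (b n) \ E) := by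
      intro n
      rcases (hab n).eq_or_lt with hn | hn
      · simp [hn]
      have hsub : Ioo (a n) (b n) ⊆ O ∩ Ioi m := hU ▸ subset_iUnion (fun n => Ioo (a n) (b n)) n
      have hb0 : b n ≤ 0 := by
        by_contra! h0
        obtain ⟨y, hy⟩ := nonempty_Ioo.2 (max_lt hn h0)
        exact absurd (hO0 (hsub ⟨(le_max_left _ _).trans_lt hy.1, hy.2⟩).1)
          (not_lt.2 ((le_max_right _ _).trans hy.1.le))
      refine hμ.measure_inter_Ioo_le hE hn hb0 fun x hx => h x _ hx.2 hb0 (fun hO' => ?_)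
        ((Ioo_subset_Ioo_left hx.1.le).trans (hsub.trans inter_subset_left))
      exact hb n ⟨hO', lt_trans (hsub hx).2 hx.2⟩
    rw [← hU, inter_iUnion, iUnion_sdiff]
    refine (measure_iUnion_le _).trans ((ENNReal.tsum_le_tsum h1).trans ?_)
    rw [ENNReal.tsum_mul_left, measure_iUnion _ fun n => measurableSet_Ioo.diff hE]
    exact fun i j hij => (hd hij).mono sdiff_subset sdiff_subset
  have hUn : E ∩ O = ⋃ n : ℕ, E ∩ (O ∩ Ioi (-(n : ℝ))) := by
    rw [← inter_iUnion, ← inter_iUnion]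
    congr 1
    refine (inter_eq_left.2 fun x _ => ?_).symm
    obtain ⟨n, hn⟩ := exists_nat_gt (-x)
    exact mem_iUnion.2 ⟨n, by simp only [mem_Ioi]; linarith⟩
  have hlim : Filter.Tendsto (fun n : ℕ => μ (E ∩ (O ∩ Ioi (-(n : ℝ))))) Filter.atTop
      (𝓝 (μ (E ∩ O))) := by
    conv => enter [3, 1, 2]; rw [hUn]
    refine tendsto_measure_iUnion_atTop fun i j hij => ?_
    have : (i : ℝ) ≤ j := by exact_mod_cast hij
    exact inter_subset_inter_right _ (inter_subset_inter_right _ (Ioi_subset_Ioi (by linarith)))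
  have hle : μ (E ∩ O) ≤ k * μ (O \ E) :=
    le_of_tendsto hlim (Filter.Eventually.of_forall fun n => (key _).trans (by
      gcongr; exact inter_subset_left))
  -- Adding `k μ(E ∩ O)` to both sides, instead of subtracting, avoids any finiteness of `μ`.
  calc (1 + k) * μ (E ∩ O) = μ (E ∩ O) + k * μ (E ∩ O) := by ring
    _ ≤ k * μ (O \ E) + k * μ (E ∩ O) := by gcongr
    _ = k * (μ (O ∩ E) + μ (O \ E)) := by rw [inter_comm]; ring
    _ = k * μ O := by rw [measure_inter_add_sdiff _ hE]

/-! ### Integration of the good `λ` inequality -/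

/-- Integration of a good `λ` inequality. -/
theorem lintegral_rpow_le_of_good_lambda {α : Type*} [MeasurableSpace α] {μ : Measure α}
    {N G : α → ℝ≥0∞} (hN : Measurable N) (hG : Measurable G) {q : ℝ} (hq : 0 < q)
    {k A : ℝ≥0} (hk : 0 < k) (hA : A ^ q = (2 * k + 1) / (2 * k))
    (hfin : ∫⁻ x, N x ^ q ∂μ < ∞)
    (h : ∀ l : ℝ≥0, 0 < l → (1 + k) * μ {x | (A * l : ℝ≥0∞) < N x ∧ G x ≤ l} ≤
      k * μ {x | l < N x}) :
    ∫⁻ x, N x ^ q ∂μ ≤ ((1 + k) * (2 * k + 1) / k : ℝ≥0) * ∫⁻ x, G x ^ q ∂μ := by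
  have hA0 : A ≠ 0 := by
    rintro rfl
    rw [NNReal.zero_rpow hq.ne'] at hA
    have : (2 * k + 1) / (2 * k) ≠ 0 := by positivity
    exact this hA.symm
  rcases eq_or_ne (∫⁻ x, G x ^ q ∂μ) ∞ with hGi | hGi
  · rw [hGi, ENNReal.mul_top (by simp; positivity)]
    exact le_top
  have hNf : ∀ᵐ x ∂μ, N x ≠ ∞ := by
    filter_upwards [ae_lt_top (hN.pow_const q) hfin.ne] with x hx h'
    simp [h', hq] at hx
  have hGf : ∀ᵐ x ∂μ, G x ≠ ∞ := by
    filter_upwards [ae_lt_top (hG.pow_const q) hGi] with x hx h'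
    simp [h', hq] at hx
  have layer : ∀ f : α → ℝ≥0∞, Measurable f → (∀ᵐ x ∂μ, f x ≠ ∞) → ∫⁻ x, f x ^ q ∂μ =
      ENNReal.ofReal q * ∫⁻ t in Ioi (0 : ℝ), μ {x | ENNReal.ofReal t < f x} *
        ENNReal.ofReal (t ^ (q - 1)) := by
    intro f hf hff
    have h1 := lintegral_rpow_eq_lintegral_meas_lt_mul μ (f := fun x => (f x).toReal)
      (Filter.Eventually.of_forall fun x => ENNReal.toReal_nonneg) hf.ennreal_toReal.aemeasurable hq
    have h2 : ∫⁻ x, f x ^ q ∂μ = ∫⁻ x, ENNReal.ofReal ((f x).toReal ^ q) ∂μ := by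
      refine lintegral_congr_ae (hff.mono fun x hx => ?_)
      beta_reduce
      rw [← ENNReal.ofReal_rpow_of_nonneg ENNReal.toReal_nonneg hq.le, ENNReal.ofReal_toReal hx]
    rw [h2, h1]
    congr 1
    refine setLIntegral_congr_fun measurableSet_Ioi fun t ht => ?_
    congr 1
    refine measure_congr (hff.mono fun x hx => propext ?_)
    exact (ENNReal.ofReal_lt_iff_lt_toReal ht.le hx).symm
  -- Layer cake formula: `{N > A t}` is covered by the set in the hypothesis and `{G > t}`, and the
  -- inequality is integrated against `q t^{q-1} dt`.
  have hlay : (1 + k) * ∫⁻ x, (N x / A) ^ q ∂μ ≤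
      k * ∫⁻ x, N x ^ q ∂μ + (1 + k) * ∫⁻ x, G x ^ q ∂μ := by
    rw [layer _ hN hNf, layer _ hG hGf, layer (fun x => N x / A) (hN.div_const _)
      (hNf.mono fun x hx => ENNReal.div_ne_top hx (by simpa using hA0))]
    set Φ := fun t : ℝ => ENNReal.ofReal (t ^ (q - 1))
    have hΦ : Measurable Φ := by fun_prop
    have hmeas : ∀ f : α → ℝ≥0∞, Measurable fun t : ℝ => μ {x | ENNReal.ofReal t < f x} * Φ t := by
      intro f
      refine Measurable.mul (Antitone.measurable fun s t hst => ?_) hΦ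
      exact measure_mono fun x hx => lt_of_le_of_lt (ENNReal.ofReal_le_ofReal hst) hx
    have e : ∀ (c d : ℝ≥0∞) (f : ℝ → ℝ≥0∞), Measurable f →
        c * (d * ∫⁻ t in Ioi (0 : ℝ), f t) = d * ∫⁻ t in Ioi (0 : ℝ), c * f t := by
      intro c d f hf
      rw [lintegral_const_mul _ hf]; ring
    rw [e _ _ _ (hmeas _), e _ _ _ (hmeas _), e _ _ _ (hmeas _), ← mul_add,
      ← lintegral_add_left ((hmeas _).const_mul _)]
    refine mul_le_mul_right (setLIntegral_mono (((hmeas _).const_mul _).add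
      ((hmeas _).const_mul _)) fun t ht => ?_) _
    simp only [Pi.add_apply, ← mul_assoc, ← add_mul]
    refine mul_le_mul_left ?_ _
    have hsub : {x | ENNReal.ofReal t < N x / A} ⊆
        {x | (A * t.toNNReal : ℝ≥0∞) < N x ∧ G x ≤ t.toNNReal} ∪ {x | ENNReal.ofReal t < G x} := by
      intro x hx
      rcases le_or_gt (G x) (ENNReal.ofReal t) with h' | h'
      · refine Or.inl ⟨?_, h'⟩
        have hx : ENNReal.ofReal t < N x / A := hx
        rw [ENNReal.lt_div_iff_mul_lt (Or.inl (by simpa using hA0)) (Or.inl ENNReal.coe_ne_top)]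
          at hx
        rwa [mul_comm]
      · exact Or.inr h'
    calc (1 + k : ℝ≥0∞) * μ {x | ENNReal.ofReal t < N x / A}
        ≤ (1 + k) * (μ {x | (A * t.toNNReal : ℝ≥0∞) < N x ∧ G x ≤ t.toNNReal} +
          μ {x | ENNReal.ofReal t < G x}) := by
          gcongr; exact (measure_mono hsub).trans (measure_union_le _ _)
      _ ≤ _ := by
          rw [mul_add]
          exact add_le_add (h _ (Real.toNNReal_pos.2 ht)) le_rfl
  -- With `A^q = 1 + 1/(2k)`, halfway between `1` and the critical value `1 + 1/k`, absorption
  -- leaves the coefficient `(1+k)/A^q - k = k/(2k+1) > 0` in front of `∫ N^q`, which is finite.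
  have hAq : (A : ℝ≥0∞) ^ q = ((2 * k + 1) / (2 * k) : ℝ≥0) := by
    rw [← ENNReal.coe_rpow_of_nonneg _ hq.le, hA]
  simp only [ENNReal.div_rpow_of_nonneg _ _ hq.le, hAq, div_eq_mul_inv (_ ^ q)] at hlay
  rw [lintegral_mul_const _ (hN.pow_const q)] at hlay
  lift ∫⁻ x, N x ^ q ∂μ to ℝ≥0 using hfin.ne with I
  lift ∫⁻ x, G x ^ q ∂μ to ℝ≥0 using hGi with J
  rw [← ENNReal.coe_inv (by positivity)] at hlay
  norm_cast at hlay ⊢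
  rw [← NNReal.coe_le_coe] at hlay ⊢
  push_cast at hlay ⊢
  have hk' : (0 : ℝ) < k := hk
  field_simp at hlay ⊢
  nlinarith

/-! ### Test functions, kernel integrals and forward operators -/

namespace IsLInftyC

variable {X : Type*} [NormedAddCommGroup X] {I : Set ℝ} {f g : ℝ → X}

theorem integrable (hf : IsLInftyC I f) : Integrable f :=
  memLp_one_iff_integrable.1 (hf.memLp_top.mono_exponent_of_measure_support_ne_top
    (s := tsupport f) (fun _ hx => image_eq_zero_of_notMem_tsupport hx)
    hf.hasCompactSupport.isCompact.measure_lt_top.ne le_top)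

theorem lintegral_rpow_lt_top (hf : IsLInftyC I f) {q : ℝ} (hq : 0 < q) :
    ∫⁻ s, ‖f s‖ₑ ^ q < ∞ := by
  have h1 : MemLp f (ENNReal.ofReal q) :=
    hf.memLp_top.mono_exponent_of_measure_support_ne_top
      (s := tsupport f) (fun _ hx => image_eq_zero_of_notMem_tsupport hx)
      hf.hasCompactSupport.isCompact.measure_lt_top.ne le_top
  have h2 := lintegral_rpow_enorm_lt_top_of_eLpNorm_lt_top (by simpa using hq)
    ENNReal.ofReal_ne_top h1.eLpNorm_lt_top
  rwa [ENNReal.toReal_ofReal hq.le] at h2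

theorem add (hf : IsLInftyC I f) (hg : IsLInftyC I g) : IsLInftyC I (f + g) :=
  ⟨hf.memLp_top.add hg.memLp_top, hf.hasCompactSupport.add hg.hasCompactSupport,
    (Function.support_add _ _).trans (union_subset hf.support_subset hg.support_subset)⟩

theorem sub (hf : IsLInftyC I f) (hg : IsLInftyC I g) : IsLInftyC I (f - g) :=
  ⟨hf.memLp_top.sub hg.memLp_top, hf.hasCompactSupport.sub hg.hasCompactSupport,
    (Function.support_sub _ _).trans (union_subset hf.support_subset hg.support_subset)⟩

theorem zero : IsLInftyC I (0 : ℝ → X) := ⟨MemLp.zero, HasCompactSupport.zero, by simp⟩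

theorem sum {ι : Type*} {s : Finset ι} {F : ι → ℝ → X} (h : ∀ i ∈ s, IsLInftyC I (F i)) :
    IsLInftyC I (∑ i ∈ s, F i) := by
  classical
  induction s using Finset.induction_on with
  | empty => simpa using zero
  | insert a s ha ih =>
    rw [Finset.sum_insert ha]
    exact (h a (by simp)).add (ih fun i hi => h i (by simp [hi]))

theorem indicator (hf : IsLInftyC I f) {s : Set ℝ} (hs : MeasurableSet s) :
    IsLInftyC I (s.indicator f) :=
  ⟨hf.memLp_top.indicator hs, hf.hasCompactSupport.mono
    (support_indicator.subset.trans inter_subset_right),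
    (support_indicator.subset.trans inter_subset_right).trans hf.support_subset⟩

theorem indicator_const {a b : ℝ} (h : Ioo a b ⊆ I) (c : X) :
    IsLInftyC I ((Ioo a b).indicator fun _ => c) :=
  ⟨(memLp_top_const c).indicator measurableSet_Ioo,
    HasCompactSupport.intro isCompact_Icc fun _ hx =>
      indicator_of_notMem (fun h => hx (Ioo_subset_Icc_self h)) _,
    support_indicator_subset.trans h⟩

theorem tsupport_subset (hf : IsLInftyC I f) (hI : IsClosed I) : tsupport f ⊆ I :=
  closure_minimal hf.support_subset hI

end IsLInftyC

section

variable {𝕜 : Type*} [RCLike 𝕜]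
  {X : Type*} [NormedAddCommGroup X] [NormedSpace 𝕜 X]
  {Y : Type*} [NormedAddCommGroup Y] [NormedSpace 𝕜 Y]

/-- The support of `f` is a compact subset of `I \ {t}`, where `K(t, ·)` is integrable, and `f` is
bounded. -/
theorem IsKernelOn.integrableOn_apply {I : Set ℝ} {K : ℝ → ℝ → X →L[𝕜] Y} (hK : IsKernelOn I K)
    (hI : IsClosed I) {f : ℝ → X} (hf : IsLInftyC I f) {t : ℝ} (ht : t ∈ I) (htf : t ∉ tsupport f) :
    IntegrableOn (fun s => K t s (f s)) I := by
  have h1 : IntegrableOn (K t) (tsupport f) :=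
    (hK.locallyIntegrableOn t ht).integrableOn_compact_subset
      (fun s hs => ⟨hf.tsupport_subset hI hs, fun h => htf (h ▸ hs)⟩) hf.hasCompactSupport.isCompact
  have h2 : IntegrableOn (fun s => K t s (f s)) (tsupport f) := by
    have hm : AEStronglyMeasurable (fun s => K t s (f s)) (volume.restrict (tsupport f)) :=
      (ContinuousLinearMap.id 𝕜 (X →L[𝕜] Y)).aestronglyMeasurable_comp₂ h1.aestronglyMeasurable
        hf.memLp_top.aestronglyMeasurable.restrict
    obtain ⟨C, hC⟩ : ∃ C : ℝ, ∀ᵐ s, ‖f s‖ ≤ C := by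
      refine ⟨(eLpNormEssSup f volume).toReal, ?_⟩
      have hlt := hf.memLp_top.eLpNorm_lt_top
      rw [eLpNorm_exponent_top] at hlt
      filter_upwards [ae_le_eLpNormEssSup (f := f) (μ := volume)] with s hs
      rw [← toReal_enorm]
      exact ENNReal.toReal_mono hlt.ne hs
    refine Integrable.mono' (h1.norm.mul_const C) hm ?_
    filter_upwards [ae_restrict_of_ae hC] with s hs
    exact ((K t s).le_opNorm _).trans (by gcongr)
  exact h2.of_forall_sdiff_eq_zero hI.measurableSet fun s hs => by
    rw [image_eq_zero_of_notMem_tsupport hs.2, map_zero]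

variable [NormedSpace ℝ Y]

theorem IsKernelOn.enorm_integral_sub_le {I : Set ℝ} {K : ℝ → ℝ → X →L[𝕜] Y} (hK : IsKernelOn I K)
    (hI : IsClosed I) {f : ℝ → X} (hf : IsLInftyC I f) {t t' : ℝ} (ht : t ∈ I) (htf : t ∉ tsupport f)
    (ht' : t' ∈ I) (htf' : t' ∉ tsupport f) :
    ‖(∫ s in I, K t s (f s)) - ∫ s in I, K t' s (f s)‖ₑ ≤
      ∫⁻ s in I, ‖K t s - K t' s‖ₑ * ‖f s‖ₑ := by
  rw [← integral_sub (hK.integrableOn_apply hI hf ht htf) (hK.integrableOn_apply hI hf ht' htf')]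
  refine (enorm_integral_le_lintegral_enorm _).trans (lintegral_mono fun s => ?_)
  rw [← sub_apply]
  exact ContinuousLinearMap.le_opENorm _ _

theorem IsKernelOn.enorm_integral_le_of_integral_eq_zero [CompleteSpace X] [CompleteSpace Y]
    [NormedSpace ℝ X]
    {I : Set ℝ} {K : ℝ → ℝ → X →L[𝕜] Y} (hK : IsKernelOn I K)
    (hI : IsClosed I) {f : ℝ → X} (hf : IsLInftyC I f) (h0 : ∫ s in I, f s = 0)
    {t : ℝ} (ht : t ∈ I) (htf : t ∉ tsupport f) (s₀ : ℝ) :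
    ‖∫ s in I, K t s (f s)‖ₑ ≤ ∫⁻ s in I, ‖K t s - K t s₀‖ₑ * ‖f s‖ₑ := by
  have h1 : ∫ s in I, K t s₀ (f s) = 0 := by
    rw [ContinuousLinearMap.integral_comp_comm _ hf.integrable.integrableOn, h0, map_zero]
  rw [← sub_zero (∫ s in I, K t s (f s)), ← h1,
    ← integral_sub (hK.integrableOn_apply hI hf ht htf)
      ((K t s₀).integrable_comp hf.integrable.integrableOn)]
  refine (enorm_integral_le_lintegral_enorm _).trans (lintegral_mono fun s => ?_)
  rw [← sub_apply]
  exact ContinuousLinearMap.le_opENorm _ _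

/-- An operator on `(-∞, 0]`, as a map of functions on the line, that is additive on `L_c^∞`,
bounded in `L^q` and given off the support by a kernel living on `t < s`. -/
structure IsForwardOperator (q : ℝ) (A : ℝ≥0) (S : (ℝ → X) → ℝ → Y) (K : ℝ → ℝ → X →L[𝕜] Y) :
    Prop where
  one_le : 1 ≤ q
  stronglyMeasurable : ∀ f, IsLInftyC (Iic 0) f → StronglyMeasurable (S f)
  map_add : ∀ f g, IsLInftyC (Iic 0) f → IsLInftyC (Iic 0) g →
    ∀ᵐ t ∂volume.restrict (Iic 0), S (f + g) t = S f t + S g t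
  bound : ∀ f, IsLInftyC (Iic 0) f →
    ∫⁻ t in Iic 0, ‖S f t‖ₑ ^ q ≤ A * ∫⁻ t in Iic 0, ‖f t‖ₑ ^ q
  isKernelOn : IsKernelOn (Iic 0) K
  eq_integral : ∀ f, IsLInftyC (Iic 0) f → ∀ᵐ t ∂volume.restrict (Iic 0),
    t ∉ tsupport f → S f t = ∫ s in Iic 0, K t s (f s)
  kernel_eq_zero : ∀ t ≤ 0, ∀ s ≤ 0, ¬ t < s → K t s = 0

namespace IsForwardOperator

variable {q : ℝ} {A : ℝ≥0} {S : (ℝ → X) → ℝ → Y} {K : ℝ → ℝ → X →L[𝕜] Y}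

/-- For `t > c` the kernel vanishes at every `s ≤ c`, and `f` vanishes at every `s > c`: data on the
left do not influence the right. -/
theorem ae_eq_zero (hS : IsForwardOperator q A S K) {f : ℝ → X} (hf : IsLInftyC (Iic 0) f) {c : ℝ}
    (hc : ∀ s, c < s → f s = 0) : ∀ᵐ t ∂volume.restrict (Iic 0), c < t → S f t = 0 := by
  have hsupp : tsupport f ⊆ Iic c := closure_minimal
    (fun s hs => not_lt.1 fun h => hs (hc s h)) isClosed_Iic
  filter_upwards [hS.eq_integral f hf, ae_restrict_mem measurableSet_Iic] with t ht ht0 hct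
  rw [ht fun h => absurd (hsupp h) (not_le.2 hct),
    setIntegral_congr_fun (g := 0) measurableSet_Iic, Pi.zero_def, integral_zero]
  intro s hs
  rcases le_or_gt s c with h | h
  · simp [hS.kernel_eq_zero t ht0 s hs (by linarith)]
  · simp [hc s h]

theorem map_sum (hS : IsForwardOperator q A S K) {ι : Type*} (s : Finset ι) {F : ι → ℝ → X}
    (hF : ∀ i ∈ s, IsLInftyC (Iic 0) (F i)) :
    ∀ᵐ t ∂volume.restrict (Iic 0), S (∑ i ∈ s, F i) t = ∑ i ∈ s, S (F i) t := by
  classical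
  induction s using Finset.induction_on with
  | empty =>
    filter_upwards [hS.map_add 0 0 IsLInftyC.zero IsLInftyC.zero] with t ht
    simpa using ht
  | insert a s ha ih =>
    filter_upwards [ih fun i hi => hF i (by simp [hi]), hS.map_add (F a) (∑ i ∈ s, F i)
      (hF a (by simp)) (IsLInftyC.sum fun i hi => hF i (by simp [hi]))] with t h1 h2
    rw [Finset.sum_insert ha, Finset.sum_insert ha, h2, h1]

end IsForwardOperator

end

/-! ### The condition `D_{1,-}` and the weak type `(1, 1)` inequality -/

theorem exists_pow_two_mul_lt_le {h x : ℝ} (hh : 0 < h) (hx : 2 * h < x) :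
    ∃ m : ℕ, 2 ^ (m + 1) * h < x ∧ x ≤ 2 ^ (m + 2) * h := by
  classical
  have hex : ∃ m : ℕ, x ≤ 2 ^ (m + 1) * h := by
    obtain ⟨n, hn⟩ := pow_unbounded_of_one_lt (x / h) (one_lt_two (α := ℝ))
    refine ⟨n, ?_⟩
    rw [div_lt_iff₀ hh] at hn
    rw [pow_succ]
    nlinarith [pow_pos (two_pos (α := ℝ)) n]
  obtain ⟨m, hm⟩ : ∃ m, Nat.find hex = m + 1 := Nat.exists_eq_succ_of_ne_zero fun h0 => by
    have := Nat.find_spec hex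
    rw [h0] at this
    norm_num at this
    linarith
  refine ⟨m, not_le.1 (Nat.find_min hex (hm ▸ Nat.lt_succ_self m)), ?_⟩
  have := Nat.find_spec hex
  rwa [hm] at this

theorem le_zero_of_Ioo_subset {a b : ℝ} (hab : a < b) (h : Ioo a b ⊆ Iic 0) : b ≤ 0 := by
  have h1 := closure_minimal h isClosed_Iic
  rw [closure_Ioo hab.ne] at h1
  exact h1 ⟨hab.le, le_rfl⟩

section

variable {𝕜 : Type*} [RCLike 𝕜]
  {X : Type*} [NormedAddCommGroup X] [NormedSpace 𝕜 X]
  {Y : Type*} [NormedAddCommGroup Y] [NormedSpace 𝕜 Y]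

/-- For `r = 1` all weights in the sum equal `1`, and the annuli cover `s - t > 2h`: this is the
one-sided Hörmander condition. -/
theorem lintegral_enorm_sub_le_dNeg_one (K : ℝ → ℝ → X →L[𝕜] Y) {s h : ℝ} (hs : s < 0)
    (hh : 0 < h) :
    ∫⁻ t in {t : ℝ | t ≤ 0 ∧ 2 * h < s - t}, ‖K t s - K t (s - h)‖ₑ ≤ dNeg 1 K := by
  have h1 : ENNReal.ofReal h ^ ((1 : ℝ) - 1 / 1) * ∑' m : ℕ,
      (2 : ℝ≥0∞) ^ (((m : ℝ) + 1) * ((1 : ℝ) - 1 / 1)) *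
      (∫⁻ t in {t : ℝ | t ≤ 0 ∧ 2 ^ (m + 1) * h < s - t ∧ s - t ≤ 2 ^ (m + 2) * h},
        ‖K t s - K t (s - h)‖ₑ ^ (1 : ℝ)) ^ ((1 : ℝ) / 1) ≤ dNeg 1 K := by
    unfold dNeg
    exact le_iSup_of_le s <| le_iSup_of_le h <| le_iSup_of_le hs <| le_iSup_of_le hh le_rfl
  simp only [div_one, sub_self, mul_zero, ENNReal.rpow_zero, one_mul, ENNReal.rpow_one] at h1
  refine le_trans ?_ h1
  refine le_trans (lintegral_mono_set fun t ht => ?_) (lintegral_iUnion_le _ _)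
  obtain ⟨m, hm⟩ := exists_pow_two_mul_lt_le hh ht.2
  exact mem_iUnion.2 ⟨m, ht.1, hm⟩

variable [NormedSpace ℝ Y]

namespace IsForwardOperator

variable {q : ℝ} {A : ℝ≥0} {S : (ℝ → X) → ℝ → Y} {K : ℝ → ℝ → X →L[𝕜] Y}

/-- To the right of `b` the image vanishes. To the left of the enlarged interval the mean zero of
`f` allows `K(t, s₀)` to be subtracted, and Tonelli reduces the claim to the Hörmander condition. -/
theorem lintegral_enorm_le_of_integral_eq_zero [CompleteSpace X] [CompleteSpace Y]
    [NormedSpace ℝ X]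
    (hS : IsForwardOperator q A S K) {f : ℝ → X} (hf : IsLInftyC (Iic 0) f) {a b : ℝ} (hab : a < b)
    (hb : b ≤ 0) (hsupp : Function.support f ⊆ Ioo a b) (h0 : ∫ s in Iic 0, f s = 0) :
    ∫⁻ t in Iic 0 \ Ioc (a - 2 * (b - a)) b, ‖S f t‖ₑ ≤ dNeg 1 K * ∫⁻ s, ‖f s‖ₑ := by
  set J := Iic (a - 2 * (b - a))
  have hJ0 : J ⊆ Iic 0 := Iic_subset_Iic.2 (by linarith)
  have hsplit : Iic 0 \ Ioc (a - 2 * (b - a)) b = J ∪ Ioc b 0 := by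
    ext t
    simp only [J, mem_sdiff, mem_Iic, mem_Ioc, mem_union]
    grind
  have hright : ∫⁻ t in Ioc b 0, ‖S f t‖ₑ = 0 := by
    have h1 := hS.ae_eq_zero hf (c := b) fun s hs => by
      by_contra h
      exact absurd (hsupp h).2 (not_lt.2 hs.le)
    have h2 := ae_restrict_of_ae_restrict_of_subset (Ioc_subset_Iic_self : Ioc b 0 ⊆ Iic 0) h1
    rw [lintegral_congr_ae (g := 0), Pi.zero_def, lintegral_zero]
    filter_upwards [h2, ae_restrict_mem measurableSet_Ioc] with t ht htm
    simp [ht htm.1]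
  have htsupp : tsupport f ⊆ Icc a b :=
    closure_minimal (hsupp.trans Ioo_subset_Icc_self) isClosed_Icc
  -- The reference point must lie to the left of the support, since `D_{1,-}` compares `s` with `s -
  -- h`. It is taken from an interval of positive length because `K(·, s₀)` is measurable only for
  -- a.e. `s₀`; the bound `a - s₀ < (b - a)/2` ensures `2(s - s₀) < s - t` for `t ≤ a - 2(b - a)`.
  obtain ⟨s₀, hs₀, hm₀⟩ : ∃ s₀ ∈ Ioo (a - (b - a) / 2) a,
      AEStronglyMeasurable (fun t => K t s₀) (volume.restrict (Iic 0)) := by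
    have h1 := hS.isKernelOn.aestronglyMeasurable.prod_swap.prodMk_left
    have h2 := ae_restrict_of_ae_restrict_of_subset
      (show Ioo (a - (b - a) / 2) a ⊆ Iic 0 from fun x hx => by
        simp only [mem_Iic]; linarith [hx.2]) h1
    have hne : (ae (volume.restrict (Ioo (a - (b - a) / 2) a))).NeBot := by
      rw [ae_neBot, Ne, Measure.restrict_eq_zero, Real.volume_Ioo]
      simp only [ENNReal.ofReal_eq_zero, not_le]
      linarith
    obtain ⟨s₀, h3, h4⟩ := (h2.and (ae_restrict_mem measurableSet_Ioo)).exists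
    exact ⟨s₀, h4, h3⟩
  have hmeas : AEMeasurable (Function.uncurry fun t s => ‖K t s - K t s₀‖ₑ * ‖f s‖ₑ)
      ((volume.restrict J).prod (volume.restrict (Iic 0))) := by
    have hle : (volume.restrict J).prod (volume.restrict (Iic (0 : ℝ))) ≤
        (volume.restrict (Iic (0 : ℝ))).prod (volume.restrict (Iic (0 : ℝ))) :=
      Measure.prod_mono (Measure.restrict_mono hJ0 le_rfl) le_rfl
    refine AEMeasurable.mono_measure ?_ hle
    exact ((hS.isKernelOn.aestronglyMeasurable.sub hm₀.comp_fst).enorm).mul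
      (hf.memLp_top.aestronglyMeasurable.restrict.comp_snd).enorm
  rw [hsplit]
  refine (lintegral_union_le _ _ _).trans ?_
  rw [hright, add_zero]
  calc ∫⁻ t in J, ‖S f t‖ₑ
      ≤ ∫⁻ t in J, ∫⁻ s in Iic 0, ‖K t s - K t s₀‖ₑ * ‖f s‖ₑ := by
        refine lintegral_mono_ae ?_
        filter_upwards [ae_restrict_of_ae_restrict_of_subset hJ0 (hS.eq_integral f hf),
          ae_restrict_mem measurableSet_Iic] with t ht htJ
        have htf : t ∉ tsupport f := fun h => by
          have h1 := (htsupp h).1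
          have h2 : t ≤ a - 2 * (b - a) := htJ
          linarith
        rw [ht htf]
        exact hS.isKernelOn.enorm_integral_le_of_integral_eq_zero isClosed_Iic hf h0 (hJ0 htJ)
          htf s₀
    _ = ∫⁻ s in Iic 0, ∫⁻ t in J, ‖K t s - K t s₀‖ₑ * ‖f s‖ₑ := lintegral_lintegral_swap hmeas
    _ ≤ ∫⁻ s in Iic 0, dNeg 1 K * ‖f s‖ₑ := by
        refine lintegral_mono fun s => ?_
        by_cases hfs : f s = 0
        · simp [hfs]
        have hs := hsupp hfs
        beta_reduce
        rw [lintegral_mul_const' _ _ enorm_ne_top]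
        gcongr
        have h1 := lintegral_enorm_sub_le_dNeg_one K (s := s) (h := s - s₀)
          (hs.2.trans_le hb) (by linarith [hs.1, hs₀.2])
        rw [sub_sub_cancel] at h1
        refine le_trans (lintegral_mono_set fun t ht => ?_) h1
        have h2 : t ≤ a - 2 * (b - a) := ht
        exact ⟨hJ0 ht, by linarith [hs₀.1, hs.2]⟩
    _ ≤ dNeg 1 K * ∫⁻ s, ‖f s‖ₑ := by
        rw [lintegral_const_mul'' _ hf.memLp_top.aestronglyMeasurable.restrict.enorm]
        gcongr
        exact Measure.restrict_le_self

end IsForwardOperator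

end

/-- An interval `(t, t + h]` with mean above `l` has to reach the support of `f`, and `h < ‖f‖₁ /
l`. -/
theorem maxFwd_enorm_bounded {X : Type*} [NormedAddCommGroup X] {I : Set ℝ} {f : ℝ → X}
    (hf : IsLInftyC I f) {l : ℝ≥0} (hl : 0 < l) :
    ∃ m : ℝ, ∀ t, (l : ℝ≥0∞) < maxFwd (fun s => ‖f s‖ₑ) t → m < t := by
  obtain ⟨R, hR⟩ := hf.hasCompactSupport.isCompact.isBounded.subset_closedBall 0
  rw [Real.closedBall_eq_Icc] at hR
  have hF : ∫⁻ s, ‖f s‖ₑ ≠ ∞ := hf.integrable.2.ne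
  refine ⟨-R - (∫⁻ s, ‖f s‖ₑ).toReal / l, fun t ht => ?_⟩
  obtain ⟨h, hh, hlt⟩ := lt_maxFwd_iff.1 ht
  have h1 : -R ≤ t + h := by
    by_contra! hc
    rw [setLIntegral_congr_fun (g := 0) measurableSet_Ioc fun s hs => by
      rw [image_eq_zero_of_notMem_tsupport fun hs' => absurd (hR hs').1 (by linarith [hs.2])]
      simp] at hlt
    simp at hlt
  have h2 := hlt.trans_le (setLIntegral_le_lintegral _ _)
  have h3 : l * h < (∫⁻ s, ‖f s‖ₑ).toReal := by
    rw [← ENNReal.ofReal_lt_iff_lt_toReal (by positivity) hF, ENNReal.ofReal_mul (by positivity)]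
    simpa using h2
  have h4 : h < (∫⁻ s, ‖f s‖ₑ).toReal / l := by
    rw [lt_div_iff₀ (by exact_mod_cast hl)]; linarith
  linarith

theorem enorm_setAverage_mul_le {X : Type*} [NormedAddCommGroup X] [NormedSpace ℝ X] (f : ℝ → X)
    (s : Set ℝ) : ‖⨍ x in s, f x‖ₑ * volume s ≤ ∫⁻ x in s, ‖f x‖ₑ := by
  rw [setAverage_eq, enorm_smul]
  by_cases h0 : volume s = 0
  · simp [h0]
  by_cases ht : volume s = ∞
  · simp [measureReal_def, ht]
  calc _ ≤ ‖(volume.real s)⁻¹‖ₑ * (∫⁻ x in s, ‖f x‖ₑ) * volume s := by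
        gcongr; exact enorm_integral_le_lintegral_enorm _
    _ = _ := by
        rw [Real.enorm_of_nonneg (by positivity), measureReal_def, ENNReal.ofReal_inv_of_pos
          (ENNReal.toReal_pos h0 ht), ENNReal.ofReal_toReal ht,
          mul_right_comm, ENNReal.inv_mul_cancel h0 ht, one_mul]

section

variable {𝕜 : Type*} [RCLike 𝕜]
  {X : Type*} [NormedAddCommGroup X] [NormedSpace 𝕜 X] [CompleteSpace X]
  {Y : Type*} [NormedAddCommGroup Y] [NormedSpace 𝕜 Y] [NormedSpace ℝ Y] [CompleteSpace Y]
  {q : ℝ} {A : ℝ≥0} {S : (ℝ → X) → ℝ → Y} {K : ℝ → ℝ → X →L[𝕜] Y}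

namespace IsForwardOperator

/-- The weak type `(1, 1)` inequality. -/
theorem mul_volume_lt_enorm_le (hS : IsForwardOperator q A S K)
    {f : ℝ → X} (hf : IsLInftyC (Iic 0) f) {l : ℝ≥0} (hl : 0 < l) :
    l * volume.restrict (Iic 0) {t | (l : ℝ≥0∞) < ‖S f t‖ₑ} ≤
      (3 + 2 ^ q * 2 * A + 4 * dNeg 1 K) * ∫⁻ s, ‖f s‖ₑ := by
  let : NormedSpace ℝ X := NormedSpace.restrictScalars ℝ 𝕜 X
  have hq := hS.one_le
  have hl0 : (l : ℝ≥0∞) ≠ 0 := by simpa using hl.ne'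
  set F := ∫⁻ s, ‖f s‖ₑ
  have hFfin : F ≠ ∞ := hf.integrable.2.ne
  set O := {t | (l : ℝ≥0∞) < maxFwd (fun s => ‖f s‖ₑ) t} with hO
  have hOopen : IsOpen O := isOpen_lt_maxFwd _ _
  have hf0 : ∀ s, 0 < s → f s = 0 := fun s hs => by
    by_contra h
    exact absurd (hf.support_subset h) (not_le.2 hs)
  have hOle : ∀ t ∉ O, ∀ h > 0, ∫⁻ s in Ioc t (t + h), ‖f s‖ₑ ≤ l * ENNReal.ofReal h :=
    fun t ht => maxFwd_le_iff.1 (not_lt.1 ht)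
  obtain ⟨m, hm⟩ := maxFwd_enorm_bounded hf hl
  have hO0 : O ⊆ Ioo m 0 := fun t ht => ⟨hm t ht, by
    by_contra! h
    have h1 : (l : ℝ≥0∞) < maxFwd (fun s => ‖f s‖ₑ) t := ht
    rw [maxFwd_eq_zero (c := 0) (fun s hs => by simp [hf0 s hs]) h] at h1
    exact not_lt_zero h1⟩
  have hOvol : l * volume O ≤ F :=
    mul_volume_lt_maxFwd_le (c := 0) (fun s hs => by simp [hf0 s hs]) l
  obtain ⟨a, b, hab, ha, hb, hd, hU⟩ := hOopen.exists_disjoint_iUnion_Ioo hO0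
  have hsubO : ∀ n, Ioo (a n) (b n) ⊆ O := fun n => hU ▸ subset_iUnion (fun n => Ioo (a n) (b n)) n
  have hsub0 : ∀ n, Ioo (a n) (b n) ⊆ Iic 0 := fun n x hx => (hO0 (hsubO n hx)).2.le
  let c : ℕ → X := fun n => ⨍ s in Ioo (a n) (b n), f s
  have hcI : ∀ n, ∫⁻ s in Ioo (a n) (b n), ‖c n‖ₑ ≤ ∫⁻ s in Ioo (a n) (b n), ‖f s‖ₑ := fun n => by
    rw [setLIntegral_const]; exact enorm_setAverage_mul_le _ _
  -- The left end `a n` is outside `O`, so the forward mean of `|f|` from there is at most `l`.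
  have hcl : ∀ n, (Ioo (a n) (b n)).Nonempty → ‖c n‖ₑ ≤ l := by
    intro n hn
    have hlt : a n < b n := nonempty_Ioo.1 hn
    have h1 := enorm_setAverage_mul_le f (Ioo (a n) (b n))
    have h2 := hOle _ (ha n) (b n - a n) (by linarith)
    rw [add_sub_cancel, ← restrict_Ioo_eq_restrict_Ioc] at h2
    rw [Real.volume_Ioo] at h1
    exact (ENNReal.mul_le_mul_iff_left (by simpa using hlt) ENNReal.ofReal_ne_top).1 (h1.trans h2)
  let β : ℕ → ℝ → X := fun n => (Ioo (a n) (b n)).indicator f - (Ioo (a n) (b n)).indicator fun _ => c n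
  have hβ : ∀ n, IsLInftyC (Iic 0) (β n) := fun n =>
    (hf.indicator measurableSet_Ioo).sub (IsLInftyC.indicator_const (hsub0 n) _)
  have hβin : ∀ n, ∀ s ∈ Ioo (a n) (b n), β n s = f s - c n := fun n s hs => by
    simp [β, indicator_of_mem hs]
  have hβout : ∀ n, ∀ s ∉ Ioo (a n) (b n), β n s = 0 := fun n s hs => by
    simp [β, indicator_of_notMem hs]
  have hβint : ∀ n, ∫⁻ s, ‖β n s‖ₑ ≤ 2 * ∫⁻ s in Ioo (a n) (b n), ‖f s‖ₑ := by
    intro n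
    calc ∫⁻ s, ‖β n s‖ₑ = ∫⁻ s in Ioo (a n) (b n), ‖β n s‖ₑ := by
          rw [← lintegral_indicator measurableSet_Ioo]
          refine lintegral_congr fun s => ?_
          by_cases hs : s ∈ Ioo (a n) (b n)
          · rw [indicator_of_mem hs]
          · rw [indicator_of_notMem hs, hβout n s hs, enorm_zero]
      _ ≤ ∫⁻ s in Ioo (a n) (b n), (‖f s‖ₑ + ‖c n‖ₑ) := by
          refine setLIntegral_mono' measurableSet_Ioo fun s hs => ?_
          rw [hβin n s hs]
          exact enorm_sub_le
      _ ≤ _ := by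
          rw [lintegral_add_right _ measurable_const, two_mul]
          exact add_le_add le_rfl (hcI n)
  have hβ0 : ∀ n, ∫ s in Iic 0, β n s = 0 := by
    intro n
    have h1 : ∫ s in Iic 0, β n s = ∫ s in Ioo (a n) (b n), β n s :=
      setIntegral_eq_of_subset_of_forall_sdiff_eq_zero measurableSet_Iic (hsub0 n)
        fun s hs => hβout n s hs.2
    rw [h1, setIntegral_congr_fun measurableSet_Ioo (hβin n)]
    exact integral_sub_average _ f
  have hSβ : ∀ n, ∫⁻ t in Iic 0 \ Ioc (a n - 2 * (b n - a n)) (b n), ‖S (β n) t‖ₑ ≤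
      dNeg 1 K * (2 * ∫⁻ s in Ioo (a n) (b n), ‖f s‖ₑ) := by
    intro n
    rcases (hab n).eq_or_lt with h | h
    · have h1 : β n = 0 := by
        ext s; exact hβout n s (by simp [h])
      rw [lintegral_congr_ae (g := 0)]
      · simp
      · refine ae_restrict_of_ae_restrict_of_subset sdiff_subset ?_
        filter_upwards [hS.map_sum (∅ : Finset ℕ) (F := β) (by simp)] with t ht
        simp only [Finset.sum_empty] at ht
        simp [h1, ht]
    · refine (hS.lintegral_enorm_le_of_integral_eq_zero (hβ n) h
        (le_zero_of_Ioo_subset h (hsub0 n)) (fun s hs => ?_) (hβ0 n)).trans ?_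
      · by_contra h'
        exact hs (hβout n s h')
      · gcongr; exact hβint n
  have hsumI : ∀ n, ∑ j ∈ Finset.range n, ∫⁻ s in Ioo (a j) (b j), ‖f s‖ₑ ≤ F := by
    intro n
    rw [← lintegral_biUnion_finset (fun i _ j _ hij => hd hij) fun _ _ => measurableSet_Ioo]
    exact setLIntegral_le_lintegral _ _
  -- Since `S` is additive for finite sums only, just the first `n` bad pieces are removed. The
  -- others stay in the good part, where they cost the `L^q` mass `tail n`, which tends to `0`.
  let tail : ℕ → ℝ≥0∞ := fun n =>
    ∫⁻ s in O \ ⋃ j ∈ Finset.range n, Ioo (a j) (b j), ‖f s‖ₑ ^ q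
  have htail : Filter.Tendsto tail Filter.atTop (𝓝 0) := by
    have hm : ∀ n, MeasurableSet (O \ ⋃ j ∈ Finset.range n, Ioo (a j) (b j)) := fun n =>
      hOopen.measurableSet.diff (Finset.measurableSet_biUnion _ fun _ _ => measurableSet_Ioo)
    have h1 := tendsto_measure_iInter_atTop (μ := volume.withDensity fun s => ‖f s‖ₑ ^ q)
      (s := fun n => O \ ⋃ j ∈ Finset.range n, Ioo (a j) (b j))
      (fun n => (hm n).nullMeasurableSet)
      (fun i j hij => sdiff_subset_sdiff_right (biUnion_subset_biUnion_left
        (by simpa using hij))) ⟨0, by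
        rw [withDensity_apply _ (hm 0)]
        exact ((setLIntegral_le_lintegral _ _).trans_lt
          (hf.lintegral_rpow_lt_top (by linarith))).ne⟩
    have h2 : (⋂ n, O \ ⋃ j ∈ Finset.range n, Ioo (a j) (b j)) = ∅ := by
      refine eq_empty_of_forall_notMem fun x hx => ?_
      rw [mem_iInter] at hx
      have hxO := (hx 0).1
      rw [← hU, mem_iUnion] at hxO
      obtain ⟨j, hj⟩ := hxO
      exact (hx (j + 1)).2 (mem_biUnion (by simp : j ∈ Finset.range (j + 1)) hj)
    rw [h2, measure_empty] at h1
    refine h1.congr fun n => ?_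
    simp only [Function.comp, withDensity_apply _ (hm n), tail]
  have hrpow : ∀ x : ℝ≥0∞, x ≤ l → x ^ q ≤ l ^ (q - 1) * x := fun x hx => by
    calc x ^ q = x ^ (q - 1) * x := by
          conv_lhs => rw [show q = q - 1 + 1 by ring]
          rw [ENNReal.rpow_add_of_nonneg _ _ (by linarith) zero_le_one, ENNReal.rpow_one]
      _ ≤ _ := by gcongr
  have hflt : ∀ᵐ s, s ∉ O → ‖f s‖ₑ ≤ l := by
    filter_upwards [ae_le_maxFwd hf.memLp_top.aestronglyMeasurable.enorm
      fun R => ((setLIntegral_le_lintegral _ _).trans_lt hFfin.lt_top).ne] with s hs hsO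
    exact hs.trans (not_lt.1 hsO)
  have hgood : ∀ n, ∫⁻ s, ‖(f - ∑ j ∈ Finset.range n, β j) s‖ₑ ^ q ≤
      l ^ (q - 1) * (2 * F) + tail n := by
    intro n
    have hm : MeasurableSet (O \ ⋃ j ∈ Finset.range n, Ioo (a j) (b j)) :=
      hOopen.measurableSet.diff (Finset.measurableSet_biUnion _ fun _ _ => measurableSet_Ioo)
    have hfm := hf.memLp_top.aestronglyMeasurable.enorm
    have hcm : ∀ j, Measurable ((Ioo (a j) (b j)).indicator fun _ => ‖c j‖ₑ) := fun j =>
      measurable_const.indicator measurableSet_Ioo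
    calc ∫⁻ s, ‖(f - ∑ j ∈ Finset.range n, β j) s‖ₑ ^ q
        ≤ ∫⁻ s, (l ^ (q - 1) * (‖f s‖ₑ + ∑ j ∈ Finset.range n,
            (Ioo (a j) (b j)).indicator (fun _ => ‖c j‖ₑ) s) +
          (O \ ⋃ j ∈ Finset.range n, Ioo (a j) (b j)).indicator (fun s => ‖f s‖ₑ ^ q) s) := by
          refine lintegral_mono_ae (hflt.mono fun s hs => ?_)
          rw [Pi.sub_apply, Finset.sum_apply]
          by_cases hsn : ∃ j ∈ Finset.range n, s ∈ Ioo (a j) (b j)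
          · obtain ⟨j, hj, hsj⟩ := hsn
            have h1 : ∑ i ∈ Finset.range n, β i s = f s - c j := by
              rw [Finset.sum_eq_single_of_mem j hj, hβin j s hsj]
              exact fun i _ hij => hβout i s (Set.disjoint_right.1 (hd hij) hsj)
            rw [h1, sub_sub_cancel]
            refine le_add_right ((hrpow _ (hcl j ⟨s, hsj⟩)).trans ?_)
            refine mul_le_mul_right (le_add_left ?_) _
            refine le_trans ?_ (Finset.single_le_sum (fun _ _ => zero_le) hj)
            rw [indicator_of_mem hsj]
          · have h1 : ∑ i ∈ Finset.range n, β i s = 0 :=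
              Finset.sum_eq_zero fun i hi => hβout i s fun h => hsn ⟨i, hi, h⟩
            rw [h1, sub_zero]
            by_cases hsO : s ∈ O
            · refine le_add_left ?_
              rw [indicator_of_mem]
              exact ⟨hsO, fun h => hsn (by simpa only [mem_iUnion, exists_prop] using h)⟩
            · refine le_add_right ((hrpow _ (hs hsO)).trans ?_)
              exact mul_le_mul_right (le_add_right le_rfl) _
      _ = l ^ (q - 1) * (F + ∑ j ∈ Finset.range n, ∫⁻ s in Ioo (a j) (b j), ‖c j‖ₑ) + tail n := by
          have hsm : Measurable fun s => ∑ j ∈ Finset.range n,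
              (Ioo (a j) (b j)).indicator (fun _ => ‖c j‖ₑ) s :=
            Finset.measurable_fun_sum _ fun j _ => hcm j
          rw [lintegral_add_right' _ ((hfm.pow_const q).indicator hm), lintegral_indicator hm,
            lintegral_const_mul'' _ (hfm.fun_add hsm.aemeasurable), lintegral_add_left' hfm,
            lintegral_finsetSum _ fun j _ => hcm j]
          simp only [lintegral_indicator measurableSet_Ioo]
          rfl
      _ ≤ _ := by
          rw [two_mul]
          gcongr
          exact (Finset.sum_le_sum fun j _ => hcI j).trans (hsumI n)
  have main : ∀ n, l * volume.restrict (Iic 0) {t | (l : ℝ≥0∞) < ‖S f t‖ₑ} ≤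
      (3 + 2 ^ q * 2 * A + 4 * dNeg 1 K) * F + 2 ^ q * l ^ (1 - q) * A * tail n := by
    intro n
    set g := f - ∑ j ∈ Finset.range n, β j with hg
    have hβs : IsLInftyC (Iic 0) (∑ j ∈ Finset.range n, β j) := IsLInftyC.sum fun j _ => hβ j
    have hgL : IsLInftyC (Iic 0) g := hf.sub hβs
    set Ω := ⋃ j ∈ Finset.range n, Ioc (a j - 2 * (b j - a j)) (b j) with hΩ
    have hΩm : MeasurableSet Ω := Finset.measurableSet_biUnion _ fun _ _ => measurableSet_Ioc
    have hsplit : ∀ᵐ t ∂volume.restrict (Iic 0), ‖S f t‖ₑ ≤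
        ‖S g t‖ₑ + ∑ j ∈ Finset.range n, ‖S (β j) t‖ₑ := by
      filter_upwards [hS.map_add g _ hgL hβs, hS.map_sum (Finset.range n) fun j _ => hβ j]
        with t h1 h2
      rw [hg, sub_add_cancel, ← hg] at h1
      rw [h1, h2]
      exact (enorm_add_le _ _).trans (add_le_add le_rfl (enorm_sum_le _ _))
    set μ := volume.restrict (Iic (0 : ℝ))
    have h1 : l * μ Ω ≤ 3 * F := by
      have h2 : μ Ω ≤ ∑ j ∈ Finset.range n, 3 * volume (Ioo (a j) (b j)) := by
        refine (Measure.restrict_le_self Ω).trans ((measure_biUnion_finset_le _ _).trans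
          (Finset.sum_le_sum fun j _ => ?_))
        rw [Real.volume_Ioc, Real.volume_Ioo, show (3 : ℝ≥0∞) = ENNReal.ofReal 3 by simp,
          ← ENNReal.ofReal_mul (by norm_num)]
        exact ENNReal.ofReal_le_ofReal (by linarith)
      calc l * μ Ω ≤ l * ∑ j ∈ Finset.range n, 3 * volume (Ioo (a j) (b j)) := by gcongr
        _ = 3 * (l * ∑ j ∈ Finset.range n, volume (Ioo (a j) (b j))) := by
            rw [← Finset.mul_sum]; ring
        _ ≤ 3 * (l * volume O) := by
            gcongr
            rw [← measure_biUnion_finset (fun i _ j _ hij => hd hij) fun _ _ => measurableSet_Ioo]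
            exact measure_mono (iUnion₂_subset fun j _ => hsubO j)
        _ ≤ 3 * F := by gcongr
    have h2 : l * μ {t | ((l : ℝ≥0∞) / 2) ^ q ≤ ‖S g t‖ₑ ^ q} ≤
        2 ^ q * 2 * A * F + 2 ^ q * l ^ (1 - q) * A * tail n := by
      have h3 := (mul_meas_ge_le_lintegral₀ (μ := μ)
        ((hS.stronglyMeasurable g hgL).enorm.pow_const q).aemeasurable (((l : ℝ≥0∞) / 2) ^ q)).trans
          ((hS.bound g hgL).trans
            (mul_le_mul_right ((setLIntegral_le_lintegral _ _).trans (hgood n)) _))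
      have h4 : (l : ℝ≥0∞) = 2 ^ q * l ^ (1 - q) * ((l : ℝ≥0∞) / 2) ^ q := by
        rw [ENNReal.div_rpow_of_nonneg _ _ (by linarith), mul_right_comm, mul_comm (2 ^ q : ℝ≥0∞),
          ENNReal.div_mul_cancel (by simp) (ENNReal.rpow_ne_top_of_nonneg (by linarith) (by simp)),
          ← ENNReal.rpow_add _ _ hl0 ENNReal.coe_ne_top]
        simp
      have h5 : (l : ℝ≥0∞) ^ (1 - q) * l ^ (q - 1) = 1 := by
        rw [← ENNReal.rpow_add _ _ hl0 ENNReal.coe_ne_top]; simp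
      calc l * μ {t | ((l : ℝ≥0∞) / 2) ^ q ≤ ‖S g t‖ₑ ^ q}
          = 2 ^ q * l ^ (1 - q) *
            (((l : ℝ≥0∞) / 2) ^ q * μ {t | ((l : ℝ≥0∞) / 2) ^ q ≤ ‖S g t‖ₑ ^ q}) := by
            conv_lhs => enter [1]; rw [h4]
            ring
        _ ≤ 2 ^ q * l ^ (1 - q) * (A * (l ^ (q - 1) * (2 * F) + tail n)) := by gcongr
        _ = 2 ^ q * 2 * A * F * (l ^ (1 - q) * l ^ (q - 1)) + 2 ^ q * l ^ (1 - q) * A * tail n := by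
            ring
        _ = _ := by rw [h5, mul_one]
    have h3 : l * μ.restrict Ωᶜ {t | (l : ℝ≥0∞) / 2 ≤ ∑ j ∈ Finset.range n, ‖S (β j) t‖ₑ} ≤
        4 * dNeg 1 K * F := by
      have hm : ∀ j, Measurable fun t => ‖S (β j) t‖ₑ := fun j =>
        (hS.stronglyMeasurable _ (hβ j)).enorm
      have h4 := mul_meas_ge_le_lintegral (μ := μ.restrict Ωᶜ)
        (Finset.measurable_fun_sum (Finset.range n) fun j _ => hm j) ((l : ℝ≥0∞) / 2)
      calc _ = 2 * ((l : ℝ≥0∞) / 2 * μ.restrict Ωᶜ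
            {t | (l : ℝ≥0∞) / 2 ≤ ∑ j ∈ Finset.range n, ‖S (β j) t‖ₑ}) := by
            rw [← mul_assoc, ENNReal.mul_div_cancel (by simp) (by simp)]
        _ ≤ 2 * ∑ j ∈ Finset.range n, dNeg 1 K * (2 * ∫⁻ s in Ioo (a j) (b j), ‖f s‖ₑ) := by
            refine mul_le_mul_right (h4.trans ?_) _
            rw [lintegral_finsetSum _ fun j _ => hm j]
            refine Finset.sum_le_sum fun j hj => le_trans ?_ (hSβ j)
            rw [Measure.restrict_restrict hΩm.compl]
            refine lintegral_mono_set fun t ht => ⟨ht.2, fun h => ht.1 ?_⟩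
            exact mem_biUnion hj h
        _ ≤ _ := by
            rw [← Finset.mul_sum, ← Finset.mul_sum]
            calc _ = 4 * dNeg 1 K * ∑ j ∈ Finset.range n, ∫⁻ s in Ioo (a j) (b j), ‖f s‖ₑ := by ring
              _ ≤ _ := by gcongr; exact hsumI n
    -- Outside `Ω`, either the good part or the sum of the bad parts is at least `l/2`. The three
    -- terms yield the constants `3` (enlargement of the intervals), `2^q · 2A` and `4 D_{1,-}`.
    have h4 : μ {t | (l : ℝ≥0∞) < ‖S f t‖ₑ} ≤ μ Ω +
        (μ {t | ((l : ℝ≥0∞) / 2) ^ q ≤ ‖S g t‖ₑ ^ q} +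
        μ.restrict Ωᶜ {t | (l : ℝ≥0∞) / 2 ≤ ∑ j ∈ Finset.range n, ‖S (β j) t‖ₑ}) := by
      rw [Measure.restrict_apply' hΩm.compl]
      refine le_trans (measure_mono_ae ?_) ((measure_union_le _ _).trans
        (add_le_add le_rfl (measure_union_le _ _)))
      filter_upwards [hsplit] with t ht htl
      by_cases htΩ : t ∈ Ω
      · exact Or.inl htΩ
      refine Or.inr ?_
      rcases le_or_gt ((l : ℝ≥0∞) / 2) ‖S g t‖ₑ with h5 | h5
      · exact Or.inl (ENNReal.rpow_le_rpow h5 (by linarith))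
      · refine Or.inr ⟨?_, htΩ⟩
        by_contra! h6
        have h7 : (l : ℝ≥0∞) < ‖S f t‖ₑ := htl
        refine absurd (h7.trans_le ht) (not_lt.2 ?_)
        rw [← ENNReal.add_halves (l : ℝ≥0∞)]
        exact add_le_add h5.le (not_le.1 h6).le
    calc _ ≤ _ := mul_le_mul_right h4 _
      _ = _ := by rw [mul_add, mul_add]
      _ ≤ _ := add_le_add h1 (add_le_add h2 h3)
      _ = _ := by ring
  refine ge_of_tendsto' (f := fun n : ℕ => (3 + 2 ^ q * 2 * A + 4 * dNeg 1 K) * F +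
    2 ^ q * l ^ (1 - q) * A * tail n) (x := Filter.atTop) ?_ main
  have h1 : (2 : ℝ≥0∞) ^ q * l ^ (1 - q) * A ≠ ∞ :=
    ENNReal.mul_ne_top (ENNReal.mul_ne_top (ENNReal.rpow_ne_top_of_nonneg (by linarith) (by simp))
      (ENNReal.rpow_ne_top_of_ne_zero hl0 ENNReal.coe_ne_top)) ENNReal.coe_ne_top
  simpa using (ENNReal.Tendsto.const_mul htail (Or.inr h1)).const_add
    ((3 + 2 ^ q * 2 * A + 4 * dNeg 1 K) * F)

end IsForwardOperator

end

/-! ### Kolmogorov's inequality, the condition `D'_{r,-}` and the local estimate -/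

/-- Kolmogorov's inequality for the exponent `1 / 2`. -/
theorem lintegral_rpow_half_le_of_weak {α : Type*} [MeasurableSpace α] {μ ν : Measure α}
    (hνμ : ν ≤ μ) {u : α → ℝ≥0∞} (hu : Measurable u) {B : ℝ≥0∞} (hB : B ≠ ∞)
    (h : ∀ l : ℝ≥0, 0 < l → l * μ {x | (l : ℝ≥0∞) < u x} ≤ B) {s₀ : ℝ≥0} (hs : 0 < s₀) :
    ∫⁻ x, u x ^ (1 / 2 : ℝ) ∂ν ≤ s₀ * ν univ + B / s₀ := by
  -- The weak bound at arbitrarily high levels forces `{u = ∞}` to be null; this permits the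
  -- real-valued layer cake formula.
  have hfin : ∀ᵐ x ∂ν, u x ≠ ∞ := by
    suffices h0 : ∀ᵐ x ∂μ, u x ≠ ∞ from ae_mono hνμ h0
    rw [ae_iff]
    by_contra hne
    have h1 : ∀ n : ℕ, (n + 1 : ℝ≥0∞) * μ {x | ¬ u x ≠ ∞} ≤ B := fun n => by
      refine le_trans ?_ (h (n + 1) (by positivity))
      push_cast
      refine mul_le_mul_right (measure_mono fun x hx => ?_) _
      simp only [ne_eq, not_not, mem_ofPred_eq] at hx ⊢
      rw [hx]; exact_mod_cast ENNReal.coe_lt_top (r := (n : ℝ≥0) + 1)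
    obtain ⟨n, hn⟩ := ENNReal.exists_nat_mul_gt hne hB
    exact absurd (h1 n) (not_le.2 (hn.trans_le (by gcongr; exact le_self_add)))
  have h2 : ∫⁻ x, u x ^ (1 / 2 : ℝ) ∂ν = ∫⁻ t in Ioi (0 : ℝ), ν {x | t < (u x).toReal ^ (1 / 2 : ℝ)} := by
    rw [← lintegral_eq_lintegral_meas_lt ν
      (Filter.Eventually.of_forall fun x => Real.rpow_nonneg ENNReal.toReal_nonneg _)
      (hu.ennreal_toReal.pow_const _).aemeasurable]
    refine lintegral_congr_ae (hfin.mono fun x hx => ?_)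
    beta_reduce
    rw [← ENNReal.ofReal_rpow_of_nonneg ENNReal.toReal_nonneg (by norm_num),
      ENNReal.ofReal_toReal hx]
  have hs' : (0 : ℝ) < s₀ := hs
  -- Below `s₀` the distribution function is bounded by the total mass; above, the weak bound at
  -- level `t²` gives `B t^{-2}`, with integral `B / s₀`.
  rw [h2, ← Ioc_union_Ioi_eq_Ioi hs'.le]
  refine (lintegral_union_le _ _ _).trans (add_le_add ?_ ?_)
  · calc _ ≤ ∫⁻ t in Ioc (0 : ℝ) s₀, ν univ := lintegral_mono fun t => measure_mono (subset_univ _)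
      _ = _ := by rw [setLIntegral_const, Real.volume_Ioc, sub_zero, ENNReal.ofReal_coe_nnreal,
          mul_comm]
  · calc _ ≤ ∫⁻ t in Ioi (s₀ : ℝ), B * ENNReal.ofReal (t ^ (-2 : ℝ)) := by
          refine setLIntegral_mono' measurableSet_Ioi fun t ht => ?_
          have ht0 : 0 < t := hs'.trans ht
          have h3 := h (Real.toNNReal (t ^ 2)) (by simpa using pow_pos ht0 2)
          have h4 : {x | t < (u x).toReal ^ (1 / 2 : ℝ)} ⊆
              {x | ((Real.toNNReal (t ^ 2) : ℝ≥0) : ℝ≥0∞) < u x} := by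
            intro x hx
            have hx : t < (u x).toReal ^ (1 / 2 : ℝ) := hx
            rw [← Real.sqrt_eq_rpow, Real.lt_sqrt ht0.le] at hx
            by_cases hux : u x = ∞
            · simp [hux]
            · exact (ENNReal.ofReal_lt_iff_lt_toReal (by positivity) hux).2 hx
          have h5 : ENNReal.ofReal (t ^ (-2 : ℝ)) = (ENNReal.ofReal (t ^ 2))⁻¹ := by
            rw [Real.rpow_neg ht0.le, ENNReal.ofReal_inv_of_pos (by positivity)]
            norm_num
          rw [h5, ← div_eq_mul_inv, ENNReal.le_div_iff_mul_le (Or.inl (by simp; positivity))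
            (Or.inl ENNReal.ofReal_ne_top), mul_comm]
          exact (mul_le_mul_right ((hνμ _).trans (measure_mono h4)) _).trans h3
      _ = _ := by
          rw [lintegral_const_mul _ (by fun_prop), ← ofReal_integral_eq_lintegral_ofReal
            (integrableOn_Ioi_rpow_of_lt (by norm_num) hs')
            ((ae_restrict_mem measurableSet_Ioi).mono fun t ht =>
              Real.rpow_nonneg (hs'.trans ht).le _), integral_Ioi_rpow_of_lt (by norm_num) hs',
            div_eq_mul_inv]
          congr 1
          rw [← ENNReal.ofReal_coe_nnreal, ← ENNReal.ofReal_inv_of_pos hs']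
          congr 1
          norm_num
          rw [Real.rpow_neg_one]

section

variable {𝕜 : Type*} [RCLike 𝕜]
  {X : Type*} [NormedAddCommGroup X] [NormedSpace 𝕜 X]
  {Y : Type*} [NormedAddCommGroup Y] [NormedSpace 𝕜 Y]
  {K : ℝ → ℝ → X →L[𝕜] Y}

/-- Hölder on each dyadic annulus around `t` of scale `h = t' - t`: the kernel factor is a term of
`D'_{r,-}`, and the factor of `f` is controlled by the maximal function at the single point `ξ ≤ t`,
since the annuli that meet the support of `f` lie in comparable intervals starting at `ξ`. -/
theorem IsKernelOn.lintegral_enorm_sub_mul_le {r : ℝ} (hr : 1 < r) (hK : IsKernelOn (Iic 0) K)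
    {f : ℝ → X} (hf : AEStronglyMeasurable f volume) {ξ t t' b L : ℝ} {M : ℝ≥0∞} (hξ : ξ ≤ t)
    (htb : t < b) (hbt : b < t') (htL : t' ≤ b + L) (ht0 : t' ≤ 0) (hL : b - ξ ≤ 2 * L)
    (hf0 : ∀ s ≤ b + 4 * L, f s = 0)
    (hM : ∀ h > 0, ∫⁻ s in Ioc ξ (ξ + h), ‖f s‖ₑ ^ r.conjExponent ≤
      M ^ r.conjExponent * ENNReal.ofReal h) :
    ∫⁻ s in Iic 0, ‖K t s - K t' s‖ₑ * ‖f s‖ₑ ≤ 4 * M * dNeg' r K := by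
  have hrr : r.HolderConjugate r.conjExponent := Real.HolderConjugate.conjExponent hr
  have hr'0 : 0 < r.conjExponent := hrr.symm.pos
  have hθ : 1 / r.conjExponent = 1 - 1 / r := by
    have := hrr.inv_add_inv_eq_one
    rw [one_div, one_div]; linarith
  have hθ0 : 0 ≤ 1 - 1 / r := hθ ▸ by positivity
  have hθ1 : 1 - 1 / r ≤ 1 := by
    have : 0 ≤ 1 / r := by positivity
    linarith
  set h := t' - t with hh
  have hh0 : 0 < h := by linarith
  let Am : ℕ → Set ℝ := fun m =>
    {s : ℝ | s ≤ 0 ∧ 2 ^ (m + 1) * h < s - t ∧ s - t ≤ 2 ^ (m + 2) * h}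
  have hAm : ∀ m, MeasurableSet (Am m) := fun m =>
    measurableSet_Iic.inter
      ((measurableSet_lt measurable_const (measurable_id.sub_const t)).inter
        (measurableSet_le (measurable_id.sub_const t) measurable_const))
  have hpow2 : ∀ m : ℕ, (2 : ℝ) ≤ 2 ^ (m + 1) := fun m => by
    calc (2 : ℝ) = 2 ^ 1 := by norm_num
      _ ≤ _ := pow_le_pow_right₀ (by norm_num) (by omega)
  have hAmt : ∀ m, ∀ s ∈ Am m, t' < s := fun m s hs => by
    have h1 := hs.2.1
    nlinarith [hpow2 m]
  have hKm : ∀ m, AEMeasurable (fun s => ‖K t s - K t' s‖ₑ) (volume.restrict (Am m)) := by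
    intro m
    have hsub : ∀ u ≤ t', Am m ⊆ Iic 0 \ {u} := fun u hu s hs =>
      ⟨hs.1, fun hsu => by
        have := hAmt m s hs
        rw [mem_singleton_iff] at hsu
        linarith⟩
    have h1 : ∀ u ≤ t', AEStronglyMeasurable (K u) (volume.restrict (Am m)) := fun u hu =>
      (hK.locallyIntegrableOn u (hu.trans ht0)).aestronglyMeasurable.mono_measure
        (Measure.restrict_mono (hsub u hu) le_rfl)
    exact ((h1 t (by linarith)).sub (h1 t' le_rfl)).enorm
  have hterm : ∀ m : ℕ, ∫⁻ s in Am m, ‖K t s - K t' s‖ₑ * ‖f s‖ₑ ≤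
      4 * M * (ENNReal.ofReal h ^ (1 - 1 / r) * ((2 : ℝ≥0∞) ^ (((m : ℝ) + 1) * (1 - 1 / r)) *
        (∫⁻ s in Am m, ‖K t s - K t' s‖ₑ ^ r) ^ (1 / r))) := by
    intro m
    -- Annuli of radius at most `4L` miss the support of `f`. For the others `t - ξ ≤ 2L < 2^{m+1}
    -- h`, so the annulus lies in `(ξ, ξ + 4 · 2^{m+1} h]`.
    rcases le_or_gt (2 ^ (m + 2) * h) (4 * L) with hm | hm
    · rw [setLIntegral_congr_fun (g := 0) (hAm m) fun s hs => by
        rw [hf0 s (by linarith [hs.2.2])]; simp]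
      simp
    · have h1 := ENNReal.lintegral_mul_le_Lp_mul_Lq (volume.restrict (Am m)) hrr (hKm m)
        hf.restrict.enorm
      have h2 : ∫⁻ s in Am m, ‖f s‖ₑ ^ r.conjExponent ≤
          M ^ r.conjExponent * ENNReal.ofReal (4 * (2 ^ (m + 1) * h)) := by
        have hsub : Am m ⊆ Ioc ξ (ξ + 4 * (2 ^ (m + 1) * h)) := fun s hs => by
          refine ⟨by linarith [hAmt m s hs], ?_⟩
          have := hs.2.2
          rw [pow_succ] at this hm
          linarith
        exact (lintegral_mono_set hsub).trans (hM (4 * (2 ^ (m + 1) * h)) (by positivity))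
      have h3 : (∫⁻ s in Am m, ‖f s‖ₑ ^ r.conjExponent) ^ (1 / r.conjExponent) ≤
          4 * M * (ENNReal.ofReal h ^ (1 - 1 / r) * (2 : ℝ≥0∞) ^ (((m : ℝ) + 1) * (1 - 1 / r))) := by
        calc _ ≤ (M ^ r.conjExponent * ENNReal.ofReal (4 * (2 ^ (m + 1) * h))) ^
              (1 / r.conjExponent) := by gcongr
          _ = M * (4 ^ (1 - 1 / r) * ((2 : ℝ≥0∞) ^ (((m : ℝ) + 1) * (1 - 1 / r)) *
              ENNReal.ofReal h ^ (1 - 1 / r))) := by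
            rw [ENNReal.mul_rpow_of_nonneg _ _ (by positivity), ← ENNReal.rpow_mul,
              mul_one_div_cancel hr'0.ne', ENNReal.rpow_one, hθ,
              ENNReal.ofReal_mul (by norm_num), ENNReal.ofReal_mul (by positivity),
              ENNReal.mul_rpow_of_nonneg _ _ hθ0, ENNReal.mul_rpow_of_nonneg _ _ hθ0,
              ENNReal.rpow_mul, ENNReal.ofReal_pow (by norm_num)]
            norm_num
            rw [← Nat.cast_succ, ENNReal.rpow_natCast]
          _ ≤ M * (4 * ((2 : ℝ≥0∞) ^ (((m : ℝ) + 1) * (1 - 1 / r)) *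
              ENNReal.ofReal h ^ (1 - 1 / r))) := by
            gcongr
            calc (4 : ℝ≥0∞) ^ (1 - 1 / r) ≤ 4 ^ (1 : ℝ) :=
                  ENNReal.rpow_le_rpow_of_exponent_le (by norm_num) hθ1
              _ = 4 := ENNReal.rpow_one _
          _ = _ := by ring
      calc _ ≤ _ := h1
        _ ≤ (∫⁻ s in Am m, ‖K t s - K t' s‖ₑ ^ r) ^ (1 / r) * (4 * M * (ENNReal.ofReal h ^
            (1 - 1 / r) * (2 : ℝ≥0∞) ^ (((m : ℝ) + 1) * (1 - 1 / r)))) := by gcongr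
        _ = _ := by ring
  calc ∫⁻ s in Iic 0, ‖K t s - K t' s‖ₑ * ‖f s‖ₑ
      = ∫⁻ s in Iic 0 ∩ Ioi (b + 4 * L), ‖K t s - K t' s‖ₑ * ‖f s‖ₑ := by
        rw [inter_comm, ← Measure.restrict_restrict measurableSet_Ioi,
          ← lintegral_indicator measurableSet_Ioi]
        refine lintegral_congr fun s => ?_
        by_cases hs : s ∈ Ioi (b + 4 * L)
        · rw [indicator_of_mem hs]
        · rw [indicator_of_notMem hs, hf0 s (not_lt.1 hs)]; simp
    _ ≤ ∑' m, ∫⁻ s in Am m, ‖K t s - K t' s‖ₑ * ‖f s‖ₑ := by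
        refine le_trans (lintegral_mono_set fun s hs => ?_) (lintegral_iUnion_le _ _)
        have hs2 : b + 4 * L < s := hs.2
        -- The cut at `b + 4L` is made for this: `2h ≤ 2(b - t) + 2L ≤ (b - t) + 4L < s - t`, using
        -- `b - t ≤ 2L`.
        obtain ⟨m, hm⟩ := exists_pow_two_mul_lt_le (x := s - t) hh0 (by linarith)
        exact mem_iUnion.2 ⟨m, hs.1, hm⟩
    _ ≤ _ := ENNReal.tsum_le_tsum hterm
    _ = 4 * M * (ENNReal.ofReal h ^ (1 - 1 / r) * ∑' m : ℕ,
        (2 : ℝ≥0∞) ^ (((m : ℝ) + 1) * (1 - 1 / r)) *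
        (∫⁻ s in Am m, ‖K t s - K (t + h) s‖ₑ ^ r) ^ (1 / r)) := by
        rw [ENNReal.tsum_mul_left, ENNReal.tsum_mul_left, hh, add_sub_cancel]
    _ ≤ _ := by
        gcongr
        unfold dNeg'
        exact le_iSup_of_le t <| le_iSup_of_le h <| le_iSup_of_le (by linarith) <|
          le_iSup_of_le hh0 le_rfl

variable [NormedSpace ℝ Y] {q : ℝ} {A : ℝ≥0} {S : (ℝ → X) → ℝ → Y}

/-- The constant of the weak type `(1, 1)` inequality. -/
def weakConst (q : ℝ) (A : ℝ≥0) (K : ℝ → ℝ → X →L[𝕜] Y) : ℝ≥0 :=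
  3 + 2 ^ q * 2 * A + 4 * (dNeg 1 K).toNNReal

theorem IsForwardOperator.lintegral_rpow_half_le [CompleteSpace X] [CompleteSpace Y]
    (hS : IsForwardOperator q A S K) (hD : dNeg 1 K < ∞)
    {f : ℝ → X} (hf : IsLInftyC (Iic 0) f) {J : Set ℝ} (hJ : J ⊆ Iic 0) {s₀ : ℝ≥0} (hs : 0 < s₀) :
    ∫⁻ t in J, ‖S f t‖ₑ ^ (1 / 2 : ℝ) ≤
      s₀ * volume J + weakConst q A K * (∫⁻ s, ‖f s‖ₑ) / s₀ := by
  have hq := hS.one_le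
  have h1 := lintegral_rpow_half_le_of_weak (μ := volume.restrict (Iic 0))
    (ν := volume.restrict J) (Measure.restrict_mono hJ le_rfl)
    (hS.stronglyMeasurable f hf).enorm (B := weakConst q A K * ∫⁻ s, ‖f s‖ₑ)
    (ENNReal.mul_ne_top ENNReal.coe_ne_top hf.integrable.2.ne) (fun l hl => ?_) hs
  · simpa using h1
  · refine (hS.mul_volume_lt_enorm_le hf hl).trans (le_of_eq ?_)
    rw [weakConst]
    push_cast
    rw [ENNReal.coe_rpow_of_nonneg _ (by linarith), ENNReal.coe_toNNReal hD.ne]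
    norm_num

end

/-- If a good interval sticks out beyond `b`, the protruding part has mean at most `l` and may be
cut off, so the witness can be taken inside `(t, b]`. -/
theorem lt_maxFwd_indicator_Ioc {u : ℝ → ℝ≥0∞} {l : ℝ≥0} {ξ b t : ℝ} (ht : t ∈ Ioo ξ b)
    (hb : maxFwd u b ≤ l) (hlt : (l : ℝ≥0∞) < maxFwd u t) :
    (l : ℝ≥0∞) < maxFwd ((Ioc ξ b).indicator u) t := by
  obtain ⟨h, hh, h1⟩ := lt_maxFwd_iff.1 hlt
  have hind : ∀ h', t + h' ≤ b → ∫⁻ s in Ioc t (t + h'), (Ioc ξ b).indicator u s =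
      ∫⁻ s in Ioc t (t + h'), u s := fun h' hh' =>
    setLIntegral_congr_fun measurableSet_Ioc fun s hs => by
      have hm : s ∈ Ioc ξ b := ⟨ht.1.trans hs.1, hs.2.trans hh'⟩
      exact indicator_of_mem hm _
  rcases le_or_gt (t + h) b with hc | hc
  · exact lt_maxFwd_iff.2 ⟨h, hh, by rwa [hind h hc]⟩
  · refine lt_maxFwd_iff.2 ⟨b - t, sub_pos.2 ht.2, ?_⟩
    rw [hind _ (by linarith), add_sub_cancel]
    have h2 := maxFwd_le_iff.1 hb (t + h - b) (by linarith)
    rw [add_sub_cancel] at h2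
    rw [← Ioc_union_Ioc_eq_Ioc ht.2.le hc.le] at h1
    have h3 := h1.trans_le ((lintegral_union_le _ _ _).trans (add_le_add le_rfl h2))
    rw [show h = (b - t) + (t + h - b) by ring,
      ENNReal.ofReal_add (by linarith [ht.2]) (by linarith), mul_add,
      show t + (b - t + (t + h - b)) - b = t + h - b by ring] at h3
    exact lt_of_add_lt_add_right h3

theorem maxFwd_le_add_const {g g₁ : ℝ → ℝ≥0∞} {c : ℝ≥0∞} (h : ∀ᵐ s, g s ≤ g₁ s + c) (t : ℝ) :
    maxFwd g t ≤ maxFwd g₁ t + c := by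
  refine maxFwd_le_iff.2 fun h' hh => ?_
  calc _ ≤ ∫⁻ s in Ioc t (t + h'), (g₁ s + c) := lintegral_mono_ae (ae_restrict_of_ae h)
    _ = (∫⁻ s in Ioc t (t + h'), g₁ s) + c * ENNReal.ofReal h' := by
        rw [lintegral_add_right _ measurable_const, setLIntegral_const, Real.volume_Ioc,
          add_sub_cancel_left]
    _ ≤ _ := by
        rw [add_mul]
        gcongr
        exact maxFwd_le_iff.1 le_rfl h' hh

theorem lintegral_Ioc_le_of_rpow {r : ℝ} (hr : 1 < r) {g : ℝ → ℝ≥0∞} (hg : AEMeasurable g)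
    {ξ h : ℝ} (hh : 0 < h) {M : ℝ≥0∞}
    (hM : ∫⁻ s in Ioc ξ (ξ + h), g s ^ r.conjExponent ≤ M ^ r.conjExponent * ENNReal.ofReal h) :
    ∫⁻ s in Ioc ξ (ξ + h), g s ≤ M * ENNReal.ofReal h := by
  have hrr : r.HolderConjugate r.conjExponent := Real.HolderConjugate.conjExponent hr
  have hr'0 : 0 < r.conjExponent := hrr.symm.pos
  have h1 := ENNReal.lintegral_mul_le_Lp_mul_Lq (volume.restrict (Ioc ξ (ξ + h)))
    hrr.symm hg.restrict (aemeasurable_const (b := 1))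
  simp only [Pi.mul_apply, mul_one, ENNReal.one_rpow, lintegral_const, one_mul,
    Measure.restrict_apply MeasurableSet.univ, univ_inter, Real.volume_Ioc,
    add_sub_cancel_left] at h1
  calc _ ≤ _ := h1
    _ ≤ (M ^ r.conjExponent * ENNReal.ofReal h) ^ (1 / r.conjExponent) *
        ENNReal.ofReal h ^ (1 / r) := by gcongr
    _ = M * (ENNReal.ofReal h ^ (1 / r.conjExponent) * ENNReal.ofReal h ^ (1 / r)) := by
        rw [ENNReal.mul_rpow_of_nonneg _ _ (by positivity), ← ENNReal.rpow_mul,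
          mul_one_div_cancel hr'0.ne', ENNReal.rpow_one, mul_assoc]
    _ = _ := by
        rw [← ENNReal.rpow_add _ _ (by simpa using hh) ENNReal.ofReal_ne_top, one_div, one_div,
          add_comm, hrr.inv_add_inv_eq_one, ENNReal.rpow_one]

theorem ENNReal.rpow_half_add_le (x y : ℝ≥0∞) :
    (x + y) ^ (1 / 2 : ℝ) ≤ x ^ (1 / 2 : ℝ) + y ^ (1 / 2 : ℝ) :=
  ENNReal.rpow_add_le_add_rpow _ _ (by norm_num) (by norm_num)

section

variable {𝕜 : Type*} [RCLike 𝕜]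
  {X : Type*} [NormedAddCommGroup X] [NormedSpace 𝕜 X] [CompleteSpace X]
  {Y : Type*} [NormedAddCommGroup Y] [NormedSpace 𝕜 Y] [NormedSpace ℝ Y] [CompleteSpace Y]
  {q : ℝ} {A : ℝ≥0} {S : (ℝ → X) → ℝ → Y} {K : ℝ → ℝ → X →L[𝕜] Y} {r : ℝ}

/-- The constant of the local good `λ` inequality. -/
def goodConst (q : ℝ) (A : ℝ≥0) (r : ℝ) (K : ℝ → ℝ → X →L[𝕜] Y) : ℝ≥0 :=
  2 + 6 * weakConst q A K + (4 * (dNeg' r K).toNNReal) ^ (1 / 2 : ℝ)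

namespace IsForwardOperator

theorem volume_good_lambda_le (hS : IsForwardOperator q A S K) (hD : dNeg 1 K < ∞) (hr : 1 < r)
    (hD' : dNeg' r K < ∞) {f : ℝ → X} (hf : IsLInftyC (Iic 0) f) {l γ η : ℝ≥0} (hl : 0 < l)
    (hγ : 0 < γ) (hη : 0 < η) (hγη : 4 * γ * goodConst q A r K ≤ η) {ξ b L : ℝ} (hξb : ξ < b)
    (hb0 : b ≤ 0) (hL : b - ξ ≤ 2 * L)
    (hb : maxFwd ((Iic 0).indicator fun t => ‖S f t‖ₑ ^ (1 / 2 : ℝ)) b ≤ l)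
    (hξ : maxFwd (fun s => ‖f s‖ₑ ^ r.conjExponent) ξ ≤
      (((γ * l : ℝ≥0) : ℝ≥0∞) ^ (2 : ℝ)) ^ r.conjExponent) :
    volume {t ∈ Ioo ξ b | ((1 + η) * l : ℝ≥0) <
      maxFwd ((Iic 0).indicator fun t => ‖S f t‖ₑ ^ (1 / 2 : ℝ)) t} ≤ ENNReal.ofReal (L / 2) := by
  have hL0 : 0 < L := by linarith
  set W := weakConst q A K with hW
  -- This is also the splitting level in Kolmogorov's inequality. As `‖f₁‖₁ ≤ s₀² · 6L`, both of its
  -- terms become multiples of `s₀ L`, giving the part `2 + 6W` of `goodConst`.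
  set s₀ : ℝ≥0 := γ * l with hs₀
  have hs₀0 : 0 < s₀ := mul_pos hγ hl
  set M : ℝ≥0∞ := (s₀ : ℝ≥0∞) ^ (2 : ℝ) with hM
  set u := (Iic (0 : ℝ)).indicator fun t => ‖S f t‖ₑ ^ (1 / 2 : ℝ) with hu
  let f₀ := (Iic ξ).indicator f
  let f₁ := (Ioc ξ (b + 4 * L)).indicator f
  let f₂ := (Ioi (b + 4 * L)).indicator f
  have hf₀ : IsLInftyC (Iic 0) f₀ := hf.indicator measurableSet_Iic
  have hf₁ : IsLInftyC (Iic 0) f₁ := hf.indicator measurableSet_Ioc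
  have hf₂ : IsLInftyC (Iic 0) f₂ := hf.indicator measurableSet_Ioi
  have hsum : f = f₀ + (f₁ + f₂) := by
    ext s
    simp only [Pi.add_apply, f₀, f₁, f₂, indicator_apply, mem_Iic, mem_Ioc, mem_Ioi]
    rcases le_or_gt s ξ with h1 | h1
    · have h2 : ¬ ξ < s := not_lt.2 h1
      have h3 : ¬ b + 4 * L < s := by linarith
      simp [h1, h2, h3]
    · have h2 : ¬ s ≤ ξ := not_le.2 h1
      rcases le_or_gt s (b + 4 * L) with h3 | h3
      · simp [h1, h2, h3]
      · simp [h1, h2, h3]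
  have hSsum : ∀ᵐ t ∂volume.restrict (Iic 0), ξ < t → S f t = S f₁ t + S f₂ t := by
    filter_upwards [hS.map_add f₀ _ hf₀ (hf₁.add hf₂), hS.map_add f₁ f₂ hf₁ hf₂,
      hS.ae_eq_zero hf₀ (c := ξ) fun s hs =>
        indicator_of_notMem (show s ∉ Iic ξ from not_le.2 hs) f]
      with t h1 h2 h3 ht
    rw [← hsum] at h1
    rw [h1, h2, h3 ht, zero_add]
  have hMf : ∀ h > 0, ∫⁻ s in Ioc ξ (ξ + h), ‖f s‖ₑ ^ r.conjExponent ≤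
      M ^ r.conjExponent * ENNReal.ofReal h := maxFwd_le_iff.1 hξ
  have hf₁int : ∫⁻ s, ‖f₁ s‖ₑ ≤ s₀ * (s₀ * ENNReal.ofReal (6 * L)) := by
    have h1 := lintegral_Ioc_le_of_rpow hr hf.memLp_top.aestronglyMeasurable.enorm
      (h := b + 4 * L - ξ) (by linarith) (hMf _ (by linarith))
    rw [add_sub_cancel] at h1
    simp only [f₁, enorm_indicator_eq_indicator_enorm]
    rw [lintegral_indicator measurableSet_Ioc]
    refine h1.trans ?_
    rw [← mul_assoc, hM, ENNReal.rpow_two, sq]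
    gcongr
    linarith
  have hSf₁ : ∀ J ⊆ Iic (0 : ℝ), volume J ≤ ENNReal.ofReal (2 * L) →
      ∫⁻ t in J, ‖S f₁ t‖ₑ ^ (1 / 2 : ℝ) ≤ s₀ * (2 + 6 * W) * ENNReal.ofReal L := by
    intro J hJ hJL
    refine (hS.lintegral_rpow_half_le hD hf₁ hJ hs₀0).trans ?_
    calc _ ≤ s₀ * ENNReal.ofReal (2 * L) +
          W * (s₀ * (s₀ * ENNReal.ofReal (6 * L))) / s₀ := by gcongr
      _ = s₀ * ENNReal.ofReal (2 * L) + W * (s₀ * ENNReal.ofReal (6 * L)) := by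
          congr 1
          rw [mul_left_comm, ENNReal.mul_div_right_comm, ENNReal.div_self
            (by simpa using hs₀0.ne') ENNReal.coe_ne_top, one_mul]
      _ = _ := by
          rw [ENNReal.ofReal_mul (by norm_num), ENNReal.ofReal_mul (by norm_num)]
          norm_num
          ring
  have hf₂M : ∀ h > 0, ∫⁻ s in Ioc ξ (ξ + h), ‖f₂ s‖ₑ ^ r.conjExponent ≤
      M ^ r.conjExponent * ENNReal.ofReal h := fun h hh => by
    refine le_trans (lintegral_mono fun s => ?_) (hMf h hh)
    have : ‖f₂ s‖ₑ ≤ ‖f s‖ₑ := by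
      simp only [f₂, enorm_indicator_eq_indicator_enorm]
      exact indicator_le_self' (by simp) s
    exact ENNReal.rpow_le_rpow this (Real.HolderConjugate.conjExponent hr).symm.nonneg
  have hSf₂ : ∀ᵐ t ∂volume.restrict (Iic 0), t ∈ Ioo ξ b →
      ‖S f₂ t‖ₑ ^ (1 / 2 : ℝ) ≤ l + s₀ * goodConst q A r K := by
    -- If `b + 4L ≥ 0` the far piece is zero. Otherwise `(b, b + L)` lies in the half-line and is
    -- available for averaging.
    rcases le_or_gt 0 (b + 4 * L) with hbL | hbL
    · filter_upwards [hS.ae_eq_zero hf₂ (c := ξ) fun s hs => by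
        by_contra h
        have h1 : s ≤ 0 := hf₂.support_subset h
        exact h (indicator_of_notMem (by simp only [mem_Ioi]; linarith) _)] with t ht htm
      rw [ht htm.1]
      simp
    have hJ : Ioo b (b + L) ⊆ Iic 0 := fun s hs => by
      simp only [mem_Iic]; linarith [hs.2]
    have htsupp : ∀ t, t < b + 4 * L → t ∉ tsupport f₂ := fun t ht h => by
      have : tsupport f₂ ⊆ Ici (b + 4 * L) := closure_minimal
        (fun s hs => by
          by_contra h'
          exact hs (indicator_of_notMem (fun h'' => h' (le_of_lt h'')) _)) isClosed_Ici
      exact absurd (this h) (not_le.2 ht)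
    filter_upwards [hS.eq_integral f₂ hf₂, ae_restrict_mem measurableSet_Iic] with t ht ht0 htm
    have hpt : ∀ᵐ t' ∂volume.restrict (Ioo b (b + L)), ‖S f₂ t‖ₑ ^ (1 / 2 : ℝ) ≤
        u t' + ‖S f₁ t'‖ₑ ^ (1 / 2 : ℝ) + (4 * dNeg' r K) ^ (1 / 2 : ℝ) * s₀ := by
      filter_upwards [ae_restrict_of_ae_restrict_of_subset hJ (hS.eq_integral f₂ hf₂),
        ae_restrict_of_ae_restrict_of_subset hJ hSsum, ae_restrict_mem measurableSet_Ioo]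
        with t' h1 h2 h3
      have h4 : t' ∈ Iic (0 : ℝ) := hJ h3
      have h5 : ‖S f₂ t - S f₂ t'‖ₑ ≤ 4 * M * dNeg' r K := by
        rw [ht (htsupp t (by linarith [htm.2])), h1 (htsupp t' (by linarith [h3.2]))]
        refine (hS.isKernelOn.enorm_integral_sub_le isClosed_Iic hf₂ ht0
          (htsupp t (by linarith [htm.2])) h4 (htsupp t' (by linarith [h3.2]))).trans ?_
        exact hS.isKernelOn.lintegral_enorm_sub_mul_le hr hf₂.memLp_top.aestronglyMeasurable
          htm.1.le htm.2 h3.1 h3.2.le h4 hL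
          (fun s hs => indicator_of_notMem (not_lt.2 hs) _) hf₂M
      have h6 : ‖S f₂ t‖ₑ ≤ (‖S f t'‖ₑ + ‖S f₁ t'‖ₑ) + 4 * M * dNeg' r K := by
        calc ‖S f₂ t‖ₑ = ‖(S f t' - S f₁ t') + (S f₂ t - S f₂ t')‖ₑ := by
              rw [h2 (hξb.trans h3.1)]; congr 1; abel
          _ ≤ _ := (enorm_add_le _ _).trans (add_le_add enorm_sub_le h5)
      calc ‖S f₂ t‖ₑ ^ (1 / 2 : ℝ)
          ≤ ((‖S f t'‖ₑ + ‖S f₁ t'‖ₑ) + 4 * M * dNeg' r K) ^ (1 / 2 : ℝ) := by gcongr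
        _ ≤ (‖S f t'‖ₑ ^ (1 / 2 : ℝ) + ‖S f₁ t'‖ₑ ^ (1 / 2 : ℝ)) +
            (4 * M * dNeg' r K) ^ (1 / 2 : ℝ) :=
            (ENNReal.rpow_half_add_le _ _).trans
              (add_le_add (ENNReal.rpow_half_add_le _ _) le_rfl)
        _ = _ := by
            rw [hu, indicator_of_mem h4, mul_right_comm,
              ENNReal.mul_rpow_of_nonneg _ M (by norm_num), hM, ← ENNReal.rpow_mul]
            norm_num
    -- Averaging over `t' ∈ (b, b + L)`: the mean of `u` is at most `l` by `hb`, with constant `1`,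
    -- and the remaining terms are multiples of `s₀`.
    have hint := lintegral_mono_ae hpt
    rw [setLIntegral_const, lintegral_add_right _ measurable_const, setLIntegral_const,
      Real.volume_Ioo, add_sub_cancel_left, lintegral_add_right _
      ((hS.stronglyMeasurable _ hf₁).enorm.pow_const _)] at hint
    have h1 : ∫⁻ t in Ioo b (b + L), u t ≤ l * ENNReal.ofReal L := by
      rw [restrict_Ioo_eq_restrict_Ioc]
      exact maxFwd_le_iff.1 hb L hL0
    have h2 := hSf₁ _ hJ (by
      rw [Real.volume_Ioo]; exact ENNReal.ofReal_le_ofReal (by linarith))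
    have h3 := hint.trans (add_le_add (add_le_add h1 h2) le_rfl)
    rw [← add_mul, ← add_mul, ENNReal.mul_le_mul_iff_left (by simpa using hL0)
      ENNReal.ofReal_ne_top] at h3
    refine h3.trans (le_of_eq ?_)
    rw [goodConst]
    push_cast
    rw [ENNReal.coe_rpow_of_nonneg _ (by norm_num)]
    push_cast
    rw [ENNReal.coe_toNNReal hD'.ne]
    ring
  set u₁ := (Ioc ξ b).indicator fun t => ‖S f₁ t‖ₑ ^ (1 / 2 : ℝ) with hu₁
  have hIoc : Ioc ξ b ⊆ Iic 0 := Ioc_subset_Iic_self.trans (Iic_subset_Iic.2 hb0)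
  have hle : ∀ᵐ t, (Ioc ξ b).indicator u t ≤ u₁ t + (l + s₀ * goodConst q A r K) := by
    have h1 := (ae_restrict_iff' measurableSet_Iic).1 hSf₂
    have h2 := (ae_restrict_iff' measurableSet_Iic).1 hSsum
    have h3 : ∀ᵐ t : ℝ, t ≠ b := by simp [ae_iff]
    filter_upwards [h1, h2, h3] with t h1 h2 h3
    by_cases ht : t ∈ Ioc ξ b
    · rw [indicator_of_mem ht, hu, indicator_of_mem (hIoc ht), hu₁, indicator_of_mem ht,
        h2 (hIoc ht) ht.1]
      refine (ENNReal.rpow_le_rpow (enorm_add_le _ _) (by norm_num)).trans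
        ((ENNReal.rpow_half_add_le _ _).trans (add_le_add le_rfl ?_))
      exact h1 (hIoc ht) ⟨ht.1, lt_of_le_of_ne ht.2 h3⟩
    · rw [indicator_of_notMem ht]; exact zero_le
  -- Of the excess `ηl` over `l`, the far piece uses at most `ηl/2`; the rest must come from `f₁`,
  -- to which the weak type inequality for `M⁺` applies.
  have hsub : {t ∈ Ioo ξ b | ((1 + η) * l : ℝ≥0) < maxFwd u t} ⊆
      {t | ((η / 2 * l : ℝ≥0) : ℝ≥0∞) < maxFwd u₁ t} := by
    intro t ht
    have hb' : maxFwd u b ≤ ((1 + η) * l : ℝ≥0) := hb.trans (by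
      rw [ENNReal.coe_le_coe]
      exact le_mul_of_one_le_left zero_le (by simp))
    have h1 := (lt_maxFwd_indicator_Ioc ht.1 hb' ht.2).trans_le (maxFwd_le_add_const hle t)
    by_contra h2
    refine absurd h1 (not_lt.2 ((add_le_add (not_lt.1 h2) le_rfl).trans ?_))
    rw [← ENNReal.coe_mul, ← ENNReal.coe_add, ← ENNReal.coe_add, ENNReal.coe_le_coe, hs₀]
    have h4 : γ * goodConst q A r K ≤ η / 2 := by
      rw [le_div_iff₀ two_pos]
      calc _ ≤ 4 * γ * goodConst q A r K := by
            rw [mul_comm, ← mul_assoc]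
            gcongr
            norm_num
        _ ≤ η := hγη
    calc η / 2 * l + (l + γ * l * goodConst q A r K)
        = η / 2 * l + l + γ * goodConst q A r K * l := by ring
      _ ≤ η / 2 * l + l + η / 2 * l := by gcongr
      _ = (1 + (η / 2 + η / 2)) * l := by ring
      _ = (1 + η) * l := by rw [add_halves]
  have hweak := mul_volume_lt_maxFwd_le (g := u₁) (c := b)
    (fun s hs => indicator_of_notMem (fun h => absurd h.2 (not_le.2 hs)) _) (η / 2 * l)
  rw [hu₁, lintegral_indicator measurableSet_Ioc, ← hu₁] at hweak
  have h1 := hweak.trans (hSf₁ _ hIoc (by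
    rw [Real.volume_Ioc]; exact ENNReal.ofReal_le_ofReal hL))
  refine (measure_mono hsub).trans ?_
  have h2 : ((s₀ : ℝ≥0∞) * (2 + 6 * W)) ≤ ((η / 2 * l : ℝ≥0) : ℝ≥0∞) * ENNReal.ofReal (1 / 2) := by
    rw [show ENNReal.ofReal (1 / 2) = ((1 / 2 : ℝ≥0) : ℝ≥0∞) by
      rw [← ENNReal.ofReal_coe_nnreal]; norm_num]
    norm_cast
    have h4 : γ * (2 + 6 * W) ≤ γ * goodConst q A r K := by
      exact mul_le_mul_right le_self_add _
    have h5 : 4 * (γ * (2 + 6 * W)) ≤ η := by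
      refine le_trans ?_ hγη
      rw [mul_assoc]; gcongr
    calc s₀ * (2 + 6 * W) = 4 * (γ * (2 + 6 * W)) * (1 / 4) * l := by
          rw [hs₀]; field_simp
      _ ≤ η * (1 / 4) * l := by gcongr
      _ = _ := by field_simp; norm_num
  rw [← ENNReal.mul_le_mul_iff_right (a := ((η / 2 * l : ℝ≥0) : ℝ≥0∞))
    (by simp [hη.ne', hl.ne']) ENNReal.coe_ne_top]
  calc _ ≤ _ := h1
    _ ≤ ((η / 2 * l : ℝ≥0) : ℝ≥0∞) * ENNReal.ofReal (1 / 2) * ENNReal.ofReal L := by gcongr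
    _ = _ := by
        rw [mul_assoc, ← ENNReal.ofReal_mul (by norm_num)]
        congr 2; ring

end IsForwardOperator

end

/-! ### The weighted good `λ` inequality and the estimate on `(-∞, 0]` -/

theorem HalfMass.mono {k k' : ℝ≥0} (h : k ≤ k') {μ : Measure ℝ} (hμ : HalfMass k μ) :
    HalfMass k' μ := fun a b c hab hbc hc0 hcb T hT hTs hvol =>
  (hμ a b c hab hbc hc0 hcb T hT hTs hvol).trans (by gcongr)

theorem indicator_rpow (I : Set ℝ) (g : ℝ → ℝ≥0∞) {a : ℝ} (ha : 0 < a) :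
    (I.indicator fun s => g s ^ a) = fun s => I.indicator g s ^ a := by
  ext s
  by_cases hs : s ∈ I
  · simp [indicator_of_mem hs]
  · simp [indicator_of_notMem hs, ha]

section

variable {𝕜 : Type*} [RCLike 𝕜]
  {X : Type*} [NormedAddCommGroup X] [NormedSpace 𝕜 X] [CompleteSpace X]
  {Y : Type*} [NormedAddCommGroup Y] [NormedSpace 𝕜 Y] [NormedSpace ℝ Y] [CompleteSpace Y]
  {q : ℝ} {A : ℝ≥0} {S : (ℝ → X) → ℝ → Y} {K : ℝ → ℝ → X →L[𝕜] Y} {r : ℝ}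

namespace IsForwardOperator

theorem good_lambda (hS : IsForwardOperator q A S K) (hD : dNeg 1 K < ∞) (hr : 1 < r)
    (hD' : dNeg' r K < ∞) {f : ℝ → X} (hf : IsLInftyC (Iic 0) f) {l γ η : ℝ≥0} (hl : 0 < l)
    (hγ : 0 < γ) (hη : 0 < η) (hγη : 4 * γ * goodConst q A r K ≤ η) {k : ℝ≥0} {μ : Measure ℝ}
    [NullSingletonClass μ] (hμ : HalfMass k μ) :
    (1 + k) * μ {t | ((1 + η : ℝ≥0) * l : ℝ≥0∞) <
        maxFwd ((Iic 0).indicator fun t => ‖S f t‖ₑ ^ (1 / 2 : ℝ)) t ∧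
        maxFwd (fun s => ‖f s‖ₑ ^ r.conjExponent) t ^ (1 / (2 * r.conjExponent)) / γ ≤ l} ≤
      k * μ {t | (l : ℝ≥0∞) < maxFwd ((Iic 0).indicator fun t => ‖S f t‖ₑ ^ (1 / 2 : ℝ)) t} := by
  have hr'0 : 0 < r.conjExponent := (Real.HolderConjugate.conjExponent hr).symm.pos
  set N := maxFwd ((Iic 0).indicator fun t => ‖S f t‖ₑ ^ (1 / 2 : ℝ)) with hN
  set Φ := maxFwd (fun s => ‖f s‖ₑ ^ r.conjExponent) with hΦ
  have hNm : Measurable N := measurable_maxFwd _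
  have hΦm : Measurable Φ := measurable_maxFwd _
  set O := {t | (l : ℝ≥0∞) < N t} with hO
  set E := {t | ((1 + η : ℝ≥0) * l : ℝ≥0∞) < N t ∧ Φ t ^ (1 / (2 * r.conjExponent)) / γ ≤ l}
    with hE
  have hEm : MeasurableSet E := (measurableSet_lt measurable_const hNm).inter
    (measurableSet_le ((hΦm.pow_const _).div_const _) measurable_const)
  have hEO : E ∩ O = E := inter_eq_left.2 fun t ht => lt_of_le_of_lt (by
    rw [← ENNReal.coe_mul, ENNReal.coe_le_coe]
    exact le_mul_of_one_le_left zero_le (by simp)) ht.1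
  have hO0 : O ⊆ Iio 0 := fun t ht => by
    by_contra h
    have h1 : (l : ℝ≥0∞) < N t := ht
    rw [hN, maxFwd_eq_zero (c := 0)
      (fun s hs => indicator_of_notMem (show s ∉ Iic (0 : ℝ) from not_le.2 hs) _)
      (not_lt.1 h)] at h1
    exact not_lt_zero h1
  set c : ℝ≥0 := ((γ * l) ^ (2 : ℝ)) ^ r.conjExponent with hc
  have hΦc : ∀ t ∈ E, Φ t ≤ c := fun t ht => by
    have h1 := ht.2
    rw [ENNReal.div_le_iff (by simpa using hγ.ne') ENNReal.coe_ne_top, one_div,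
      ENNReal.rpow_inv_le_iff (by positivity), ENNReal.rpow_mul] at h1
    rw [hc, ENNReal.coe_rpow_of_nonneg _ hr'0.le, ENNReal.coe_rpow_of_nonneg _ (by norm_num),
      ENNReal.coe_mul, mul_comm (γ : ℝ≥0∞)]
    exact h1
  have key := hμ.measure_inter_le hEm (isOpen_lt_maxFwd _ l) hO0 fun x b hxb hb0 hbO hsub => ?_
  · rwa [hEO] at key
  set y := (x + b) / 2 with hy
  rcases (E ∩ Ioo x y).eq_empty_or_nonempty with h0 | hne
  · simp [h0]
  have hbdd : BddBelow (E ∩ Ioo x y) := ⟨x, fun t ht => ht.2.1.le⟩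
  -- A single point to the left of all of `E ∩ (x, y)` at which `Φ` is controlled. The infimum need
  -- not belong to `E`, but `{Φ ≤ c}` is closed by lower semicontinuity. The scale `L = (b - x)/2`
  -- turns the bound `L/2` into `(b - x)/4`.
  set ξ := sInf (E ∩ Ioo x y) with hξ
  have hxξ : x ≤ ξ := le_csInf hne fun t ht => ht.2.1.le
  obtain ⟨t₀, ht₀⟩ := hne
  have hξb : ξ < b := (csInf_le hbdd ht₀).trans_lt (ht₀.2.2.trans (by linarith))
  have hξc : Φ ξ ≤ c := by
    have : ξ ∈ closure (E ∩ Ioo x y) := csInf_mem_closure ⟨t₀, ht₀⟩ hbdd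
    exact closure_minimal (fun t ht => hΦc t ht.1) (isClosed_maxFwd_le _ c) this
  have h1 := hS.volume_good_lambda_le hD hr hD' hf hl hγ hη hγη (L := (b - x) / 2) hξb hb0
    (by linarith) (not_lt.1 hbO) (by
      rw [← ENNReal.coe_rpow_of_nonneg _ (by norm_num : (0 : ℝ) ≤ 2),
        ← ENNReal.coe_rpow_of_nonneg _ hr'0.le]
      exact hξc)
  have hcover : E ∩ Ioo x y ⊆ {ξ} ∪ {t ∈ Ioo ξ b | ((1 + η) * l : ℝ≥0) < N t} := fun t ht => by
    rcases (csInf_le hbdd ht).eq_or_lt with h | h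
    · exact Or.inl h.symm
    · exact Or.inr ⟨⟨h, ht.2.2.trans (by linarith)⟩, by rw [ENNReal.coe_mul]; exact ht.1.1⟩
  refine (measure_mono hcover).trans ((measure_union_le _ _).trans ?_)
  rw [Real.volume_singleton, zero_add]
  refine h1.trans (le_of_eq ?_)
  congr 1; ring

theorem exists_coifman_const (hS : IsForwardOperator q A S K) (hD : dNeg 1 K < ∞) (hr : 1 < r)
    (hD' : dNeg' r K < ∞) {p : ℝ} (hp : 0 < p) (k : ℝ≥0) :
    ∃ C : ℝ≥0, ∀ w : ℝ → ℝ≥0, AEMeasurable w (volume.restrict (Iic 0)) →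
      HalfMass k (negMeasure w) → ∀ f, IsLInftyC (Iic 0) f →
      (∫⁻ t in Iic 0, maxFwdNeg (fun s => ‖S f s‖ₑ) t ^ p * w t) < ∞ →
      (∫⁻ t in Iic 0, ‖S f t‖ₑ ^ p * w t) ≤
        C * ∫⁻ t in Iic 0,
          maxFwdNeg (fun s => ‖f s‖ₑ ^ r.conjExponent) t ^ (p / r.conjExponent) * w t := by
  have hr'0 : 0 < r.conjExponent := (Real.HolderConjugate.conjExponent hr).symm.pos
  -- The integration lemma needs a positive constant, while `k` may be `0`.
  set k' := k + 1 with hk'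
  have hk'0 : 0 < k' := by positivity
  set B : ℝ≥0 := ((2 * k' + 1) / (2 * k')) ^ (1 / (2 * p)) with hB
  have hBp : B ^ (2 * p) = (2 * k' + 1) / (2 * k') := by
    rw [hB, ← NNReal.rpow_mul, one_div_mul_cancel (by positivity), NNReal.rpow_one]
  have hB1 : 1 < B := by
    refine NNReal.one_lt_rpow ?_ (by positivity)
    rw [lt_div_iff₀ (by positivity), one_mul]
    exact lt_add_one _
  set η := B - 1 with hη
  have hη0 : 0 < η := tsub_pos_of_lt hB1
  have hBη : 1 + η = B := add_tsub_cancel_of_le hB1.le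
  have hG0 : 0 < goodConst q A r K := by rw [goodConst]; positivity
  set γ := η / (4 * goodConst q A r K) with hγ
  have hγ0 : 0 < γ := by positivity
  have hγη : 4 * γ * goodConst q A r K ≤ η := by
    rw [hγ]; apply le_of_eq; field_simp
  refine ⟨(1 + k') * (2 * k' + 1) / k' * (γ ^ (2 * p))⁻¹, fun w hw hhalf f hf hfin => ?_⟩
  set N := maxFwd ((Iic 0).indicator fun t => ‖S f t‖ₑ ^ (1 / 2 : ℝ)) with hN
  set Φ := maxFwd (fun s => ‖f s‖ₑ ^ r.conjExponent) with hΦ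
  have hNm : Measurable N := measurable_maxFwd _
  have hΦm : Measurable Φ := measurable_maxFwd _
  have hSm := (hS.stronglyMeasurable f hf).enorm
  have hN2 : ∀ t, N t ^ (2 * p) ≤ maxFwd ((Iic 0).indicator fun s => ‖S f s‖ₑ) t ^ p := fun t => by
    rw [hN, indicator_rpow _ _ (by norm_num), ENNReal.rpow_mul]
    exact ENNReal.rpow_le_rpow (sq_maxFwd_rpow_half_le
      (hSm.indicator measurableSet_Iic).aemeasurable t) hp.le
  have hfin' : ∫⁻ t, N t ^ (2 * p) ∂negMeasure w < ∞ := by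
    rw [lintegral_negMeasure hw (hNm.pow_const _).aemeasurable]
    refine lt_of_le_of_lt (setLIntegral_mono' measurableSet_Iic fun t ht => ?_) hfin
    rw [maxFwdNeg, indicator_of_mem ht]
    exact mul_le_mul_left (hN2 t) _
  -- The exponent is `2p` because `N` is built from a square root, and `A = 1 + η = B`.
  have h1 := lintegral_rpow_le_of_good_lambda hNm ((hΦm.pow_const (1 / (2 * r.conjExponent))).div_const
    (γ : ℝ≥0∞)) (q := 2 * p) (by positivity) hk'0 hBp hfin' fun l hl => by
      rw [← hBη]
      exact hS.good_lambda hD hr hD' hf hl hγ0 hη0 hγη (hhalf.mono le_self_add)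
  -- Local integrability of `|Sf|^{1/2}`, needed for Lebesgue differentiation, comes from
  -- Kolmogorov's inequality with `s₀ = 1`.
  have hle : ∀ᵐ t, (Iic (0 : ℝ)).indicator (fun t => ‖S f t‖ₑ ^ (1 / 2 : ℝ)) t ≤ N t := by
    refine ae_le_maxFwd ((hSm.pow_const _).indicator measurableSet_Iic).aemeasurable fun R => ?_
    rw [lintegral_indicator measurableSet_Iic, Measure.restrict_restrict measurableSet_Iic]
    refine ((hS.lintegral_rpow_half_le hD hf inter_subset_left one_pos).trans_lt ?_).ne
    have hvol : volume (Iic 0 ∩ Ioo (-R) R) < ∞ :=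
      (measure_mono inter_subset_right).trans_lt (by simp)
    have h2 : ∫⁻ s, ‖f s‖ₑ < ∞ := hf.integrable.2
    simp only [ENNReal.coe_one, one_mul, div_one]
    exact ENNReal.add_lt_top.2 ⟨hvol, ENNReal.mul_lt_top ENNReal.coe_lt_top h2⟩
  calc ∫⁻ t in Iic 0, ‖S f t‖ₑ ^ p * w t
      ≤ ∫⁻ t in Iic 0, N t ^ (2 * p) * w t := by
        refine lintegral_mono_ae ?_
        filter_upwards [ae_restrict_of_ae hle, ae_restrict_mem measurableSet_Iic] with t ht ht0
        rw [indicator_of_mem ht0] at ht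
        gcongr
        calc ‖S f t‖ₑ ^ p = (‖S f t‖ₑ ^ (1 / 2 : ℝ)) ^ (2 * p) := by
              rw [← ENNReal.rpow_mul]; congr 1; ring
          _ ≤ _ := by gcongr
    _ = ∫⁻ t, N t ^ (2 * p) ∂negMeasure w :=
        (lintegral_negMeasure hw (hNm.pow_const _).aemeasurable).symm
    _ ≤ _ := h1
    _ = _ := by
        rw [lintegral_negMeasure hw (((hΦm.pow_const _).div_const _).pow_const _).aemeasurable,
          ENNReal.coe_mul, mul_assoc]
        refine congrArg _ ?_
        rw [← lintegral_const_mul' _ _ ENNReal.coe_ne_top]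
        refine setLIntegral_congr_fun measurableSet_Iic fun t ht => ?_
        have hind : (Iic (0 : ℝ)).indicator (fun s => ‖f s‖ₑ ^ r.conjExponent) =
            fun s => ‖f s‖ₑ ^ r.conjExponent := indicator_eq_self.2 fun s hs => by
          by_contra h
          have : f s = 0 := by
            by_contra h'
            exact h (hf.support_subset h')
          exact hs (by simp [this, hr'0])
        rw [maxFwdNeg, indicator_of_mem ht, hind, ← hΦ, ← mul_assoc]
        congr 1
        rw [ENNReal.div_rpow_of_nonneg _ _ (by positivity), ← ENNReal.rpow_mul, mul_comm,
          div_eq_mul_inv, mul_comm, ENNReal.coe_inv (by positivity),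
          ENNReal.coe_rpow_of_nonneg _ (by positivity)]
        congr 2
        field_simp

end IsForwardOperator

end

/-! ### Singular integral operators as forward operators -/

section

variable {𝕜 : Type*} [RCLike 𝕜]
  {X : Type*} [NormedAddCommGroup X] [NormedSpace 𝕜 X]
  {Y : Type*} [NormedAddCommGroup Y] [NormedSpace 𝕜 Y]
  {p₀ : ℝ≥0∞} [Fact (1 ≤ p₀)] {I : Set ℝ}

/-- A bounded operator on `L^{p₀}(I)` as a map of functions, with value `0` outside `L_c^∞`. -/
def opFun (T : Lp X p₀ (volume.restrict I) →L[𝕜] Lp Y p₀ (volume.restrict I)) (f : ℝ → X) :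
    ℝ → Y :=
  open Classical in
  if h : IsLInftyC I f then T ((h.memLp p₀).toLp f) else 0

theorem opFun_eq (T : Lp X p₀ (volume.restrict I) →L[𝕜] Lp Y p₀ (volume.restrict I)) {f : ℝ → X}
    (hf : IsLInftyC I f) : opFun T f = T ((hf.memLp p₀).toLp f) := by
  rw [opFun, dif_pos hf]

theorem opFun_add (T : Lp X p₀ (volume.restrict I) →L[𝕜] Lp Y p₀ (volume.restrict I))
    {f g : ℝ → X} (hf : IsLInftyC I f) (hg : IsLInftyC I g) :
    ∀ᵐ t ∂volume.restrict I, opFun T (f + g) t = opFun T f t + opFun T g t := by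
  rw [opFun_eq T hf, opFun_eq T hg, opFun_eq T (hf.add hg),
    MemLp.toLp_add (hf.memLp p₀) (hg.memLp p₀), map_add]
  exact Lp.coeFn_add _ _

theorem lintegral_opFun_le (hp₀ : p₀ ≠ ∞)
    (T : Lp X p₀ (volume.restrict I) →L[𝕜] Lp Y p₀ (volume.restrict I))
    {f : ℝ → X} (hf : IsLInftyC I f) :
    ∫⁻ t in I, ‖opFun T f t‖ₑ ^ p₀.toReal ≤
      (‖T‖₊ ^ p₀.toReal : ℝ≥0) * ∫⁻ t in I, ‖f t‖ₑ ^ p₀.toReal := by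
  have h1 : (1 : ℝ≥0∞) ≤ p₀ := Fact.out
  have hp0 : p₀ ≠ 0 := (one_pos.trans_le h1).ne'
  have hq : 0 < p₀.toReal := ENNReal.toReal_pos hp0 hp₀
  have h2 := ContinuousLinearMap.le_opENorm T ((hf.memLp p₀).toLp f)
  rw [Lp.enorm_def, Lp.enorm_toLp, ← opFun_eq T hf, eLpNorm_eq_lintegral_rpow_enorm_toReal hp0 hp₀,
    eLpNorm_eq_lintegral_rpow_enorm_toReal hp0 hp₀, one_div, ENNReal.rpow_inv_le_iff hq,
    ENNReal.mul_rpow_of_nonneg _ _ hq.le, ← ENNReal.rpow_mul, inv_mul_cancel₀ hq.ne',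
    ENNReal.rpow_one] at h2
  rwa [ENNReal.coe_rpow_of_nonneg _ hq.le]

variable [NormedSpace ℝ Y]

theorem IsSingularIntegralOperator.isForwardOperator
    {T : Lp X p₀ (volume.restrict (Iic (0 : ℝ))) →L[𝕜] Lp Y p₀ (volume.restrict (Iic (0 : ℝ)))}
    {K : ℝ → ℝ → X →L[𝕜] Y} (hT : IsSingularIntegralOperator (Iic 0) T K) (hp₀ : p₀ ≠ ∞)
    (hK : ∀ t ≤ 0, ∀ s ≤ 0, ¬ t < s → K t s = 0) :
    IsForwardOperator p₀.toReal (‖T‖₊ ^ p₀.toReal) (opFun T) K where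
  one_le := by
    have h1 : (1 : ℝ≥0∞) ≤ p₀ := Fact.out
    rwa [← ENNReal.toReal_one, ENNReal.toReal_le_toReal ENNReal.one_ne_top hp₀]
  stronglyMeasurable f hf := by rw [opFun_eq T hf]; exact Lp.stronglyMeasurable _
  map_add f g hf hg := opFun_add T hf hg
  bound f hf := lintegral_opFun_le hp₀ T hf
  isKernelOn := hT.isKernelOn
  eq_integral f hf := by rw [opFun_eq T hf]; exact hT.eq_integral f hf
  kernel_eq_zero := hK

end

/-! ### Reflection of the half-line -/

theorem measurePreserving_neg_Iic :
    MeasurePreserving (fun t : ℝ => -t) (volume.restrict (Iic 0)) (volume.restrict (Ici 0)) := by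
  have h := (Measure.measurePreserving_neg (volume : Measure ℝ)).restrict_preimage
    (measurableSet_Ici (a := (0 : ℝ)))
  convert h using 2
  ext t; simp

theorem setLIntegral_comp_neg (g : ℝ → ℝ≥0∞) {s s' : Set ℝ} (h : ∀ t, t ∈ s ↔ -t ∈ s') :
    ∫⁻ t in s, g (-t) = ∫⁻ t in s', g t := by
  rw [← (Measure.measurePreserving_neg (volume : Measure ℝ)).setLIntegral_comp_preimage_emb
    (MeasurableEquiv.neg ℝ).measurableEmbedding g s']
  congr 2
  ext t; exact h t

theorem setLIntegral_Ici_zero (g : ℝ → ℝ≥0∞) : ∫⁻ t in Ici 0, g t = ∫⁻ t in Iic 0, g (-t) :=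
  (setLIntegral_comp_neg g (by simp)).symm

theorem ae_comp_neg {P : ℝ → Prop} (h : ∀ᵐ t ∂volume.restrict (Ici 0), P t) :
    ∀ᵐ t ∂volume.restrict (Iic 0), P (-t) :=
  measurePreserving_neg_Iic.quasiMeasurePreserving.ae h

theorem maxBwdPos_neg (g : ℝ → ℝ≥0∞) (t : ℝ) :
    maxBwdPos g (-t) = maxFwdNeg (fun s => g (-s)) t := by
  have h1 : (Ici (0 : ℝ)).indicator g = fun s => (Iic (0 : ℝ)).indicator (fun s => g (-s)) (-s) := by
    ext s
    by_cases hs : 0 ≤ s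
    · rw [indicator_of_mem (show s ∈ Ici 0 from hs), indicator_of_mem (by simpa using hs), neg_neg]
    · rw [indicator_of_notMem (show s ∉ Ici 0 from hs), indicator_of_notMem (by simpa using hs)]
  have h2 : ∀ G : ℝ → ℝ≥0∞, maxBwd (fun s => G (-s)) (-t) = maxFwd G t := fun G => by
    simp only [maxBwd, maxFwd]
    refine iSup_congr fun h => iSup_congr fun hh => ?_
    congr 1
    -- Reflection exchanges the closed and the open end of the interval; the difference is a null
    -- set.
    rw [setLIntegral_comp_neg G (s' := Ico t (t + h)), restrict_Ico_eq_restrict_Ioc]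
    intro s
    simp only [mem_Ioc, mem_Ico]
    constructor <;> rintro ⟨h1, h2⟩ <;> constructor <;> linarith
  rw [maxBwdPos, maxFwdNeg, h1]
  by_cases ht : t ≤ 0
  · rw [indicator_of_mem (by simpa using ht), indicator_of_mem (show t ∈ Iic 0 from ht), h2]
  · rw [indicator_of_notMem (by simpa using ht), indicator_of_notMem (show t ∉ Iic 0 from ht)]

theorem IsLInftyC.comp_neg {X : Type*} [NormedAddCommGroup X] {I J : Set ℝ} {f : ℝ → X}
    (hf : IsLInftyC I f) (h : ∀ t, -t ∈ I → t ∈ J) : IsLInftyC J (fun t => f (-t)) :=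
  ⟨hf.memLp_top.comp_measurePreserving (Measure.measurePreserving_neg volume),
    hf.hasCompactSupport.comp_homeomorph (Homeomorph.neg ℝ),
    fun t ht => h t (hf.support_subset ht)⟩

theorem IsWeightOn.comp_neg {w : ℝ → ℝ≥0} (hw : IsWeightOn (Ici 0) w) :
    IsWeightOn (Iic 0) fun t => w (-t) :=
  ⟨hw.aemeasurable.comp_quasiMeasurePreserving measurePreserving_neg_Iic.quasiMeasurePreserving,
    ae_comp_neg hw.pos⟩

theorem AInftyBwdPos.comp_neg {w : ℝ → ℝ≥0} (hw : AInftyBwdPos w) :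
    AInftyFwdNeg fun t => w (-t) := by
  obtain ⟨hw0, C, hC, δ, hδ, h⟩ := hw
  refine ⟨hw0.comp_neg, C, hC, δ, hδ, fun a b c hab hbc hc S hS hSbc => ?_⟩
  have h1 := h (-c) (-b) (-a) (by linarith) (by linarith) (by linarith)
    ((fun t => -t) ⁻¹' S) (measurable_neg hS) fun t ht => by
      have := hSbc ht
      exact ⟨by linarith [this.2], by linarith [this.1]⟩
  have h2 : volume ((fun t : ℝ => -t) ⁻¹' S) = volume S :=
    (Measure.measurePreserving_neg (volume : Measure ℝ)).measure_preimage hS.nullMeasurableSet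
  have h3 : wMass (fun t => w (-t)) S = wMass w ((fun t => -t) ⁻¹' S) :=
    setLIntegral_comp_neg (fun t => (w t : ℝ≥0∞)) fun t => by simp
  have h4 : wMass (fun t => w (-t)) (Ioo a b) = wMass w (Ioo (-b) (-a)) :=
    setLIntegral_comp_neg (fun t => (w t : ℝ≥0∞)) fun t => by
      simp only [mem_Ioo, neg_lt_neg_iff, and_comm]
  rw [h2, ← h3, ← h4] at h1
  convert h1 using 3
  ring

section

variable {𝕜 : Type*} [RCLike 𝕜]
  {X : Type*} [NormedAddCommGroup X] [NormedSpace 𝕜 X]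
  {Y : Type*} [NormedAddCommGroup Y] [NormedSpace 𝕜 Y]

theorem dNeg_comp_neg_le (r : ℝ) (K : ℝ → ℝ → X →L[𝕜] Y) :
    dNeg r (fun t s => K (-t) (-s)) ≤ dPos r K := by
  refine iSup_le fun s => iSup_le fun h => iSup_le fun hs => iSup_le fun hh => ?_
  refine le_trans (le_of_eq ?_) (le_iSup_of_le (-s) <| le_iSup_of_le h <|
    le_iSup_of_le (neg_pos.2 hs) <| le_iSup_of_le hh le_rfl)
  congr 1
  refine tsum_congr fun m => ?_
  congr 2
  beta_reduce
  rw [show -(s - h) = -s + h by ring]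
  refine setLIntegral_comp_neg (fun t => ‖K t (-s) - K t (-s + h)‖ₑ ^ r) fun t => ?_
  simp only [mem_ofPred_eq, neg_nonneg]
  rw [show -t - -s = s - t by ring]

theorem dNeg'_comp_neg_le (r : ℝ) (K : ℝ → ℝ → X →L[𝕜] Y) :
    dNeg' r (fun t s => K (-t) (-s)) ≤ dPos' r K := by
  refine iSup_le fun t => iSup_le fun h => iSup_le fun ht => iSup_le fun hh => ?_
  refine le_trans (le_of_eq ?_) (le_iSup_of_le (-t) <| le_iSup_of_le h <|
    le_iSup_of_le (neg_pos.2 ht) <| le_iSup_of_le hh le_rfl)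
  congr 1
  refine tsum_congr fun m => ?_
  congr 2
  beta_reduce
  rw [show -(t + h) = -t - h by ring]
  refine setLIntegral_comp_neg (fun s => ‖K (-t) s - K (-t - h) s‖ₑ ^ r) fun s => ?_
  simp only [mem_ofPred_eq, neg_nonneg]
  rw [show -t - -s = s - t by ring]

theorem IsKernelOn.comp_neg {K : ℝ → ℝ → X →L[𝕜] Y} (hK : IsKernelOn (Ici 0) K) :
    IsKernelOn (Iic 0) fun t s => K (-t) (-s) where
  aestronglyMeasurable := hK.aestronglyMeasurable.comp_measurePreserving
    (measurePreserving_neg_Iic.prod measurePreserving_neg_Iic)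
  locallyIntegrableOn t ht := by
    have hlc : ∀ (s : Set ℝ) (x : ℝ), IsClosed s → IsLocallyClosed (s \ {x}) := fun s x hs =>
      hs.isLocallyClosed.inter isOpen_compl_singleton.isLocallyClosed
    rw [locallyIntegrableOn_iff (hlc _ _ isClosed_Iic)]
    intro k hk hkc
    have h1 := hK.locallyIntegrableOn (-t) (by simpa using ht)
    rw [locallyIntegrableOn_iff (hlc _ _ isClosed_Ici)] at h1
    have h2 := h1 ((fun s => -s) '' k) (by
      rintro _ ⟨s, hs, rfl⟩
      refine ⟨by simpa using (hk hs).1, fun h => (hk hs).2 ?_⟩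
      simpa using h) (hkc.image continuous_neg)
    rw [← (Measure.measurePreserving_neg (volume : Measure ℝ)).integrableOn_comp_preimage
      (MeasurableEquiv.neg ℝ).measurableEmbedding] at h2
    have h3 : Neg.neg ⁻¹' ((fun s : ℝ => -s) '' k) = k := by ext s; simp
    rwa [h3] at h2

variable {p₀ : ℝ≥0∞} [Fact (1 ≤ p₀)] [NormedSpace ℝ Y]

/-- Reflecting argument and value turns `T` into a forward operator with kernel `K(-t, -s)` and the
same bound. Since `IsForwardOperator` concerns maps of functions, no reflected operator between
`L^{p₀}` spaces has to be constructed. -/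
theorem IsSingularIntegralOperator.isForwardOperator_comp_neg
    {T : Lp X p₀ (volume.restrict (Ici (0 : ℝ))) →L[𝕜] Lp Y p₀ (volume.restrict (Ici (0 : ℝ)))}
    {K : ℝ → ℝ → X →L[𝕜] Y} (hT : IsSingularIntegralOperator (Ici 0) T K) (hp₀ : p₀ ≠ ∞)
    (hK : ∀ t ≥ 0, ∀ s ≥ 0, ¬ s < t → K t s = 0) :
    IsForwardOperator p₀.toReal (‖T‖₊ ^ p₀.toReal)
      (fun f t => opFun T (fun s => f (-s)) (-t)) fun t s => K (-t) (-s) where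
  one_le := by
    have h1 : (1 : ℝ≥0∞) ≤ p₀ := Fact.out
    rwa [← ENNReal.toReal_one, ENNReal.toReal_le_toReal ENNReal.one_ne_top hp₀]
  stronglyMeasurable f hf := by
    rw [opFun_eq T (hf.comp_neg (J := Ici 0) fun t ht => by simpa using ht)]
    exact (Lp.stronglyMeasurable _).comp_measurable measurable_neg
  map_add f g hf hg := ae_comp_neg (opFun_add T
    (hf.comp_neg (J := Ici 0) fun t ht => by simpa using ht)
    (hg.comp_neg (J := Ici 0) fun t ht => by simpa using ht))
  bound f hf := by
    have h1 := lintegral_opFun_le hp₀ T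
      (hf.comp_neg (J := Ici 0) fun t ht => by simpa using ht)
    simpa only [setLIntegral_Ici_zero, neg_neg] using h1
  isKernelOn := hT.isKernelOn.comp_neg
  eq_integral f hf := by
    have hg : IsLInftyC (Ici 0) fun s => f (-s) := hf.comp_neg fun t ht => by simpa using ht
    have h1 := hT.eq_integral _ hg
    rw [← opFun_eq T hg] at h1
    filter_upwards [ae_comp_neg h1] with t ht htf
    rw [ht fun h => htf ?_, ← measurePreserving_neg_Iic.integral_comp
      (MeasurableEquiv.neg ℝ).measurableEmbedding]
    · simp
    · have h2 : tsupport (fun s => f (-s)) = (fun s : ℝ => -s) ⁻¹' tsupport f :=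
        tsupport_comp_eq_preimage f (Homeomorph.neg ℝ)
      rw [h2] at h
      simpa using h
  kernel_eq_zero t ht s hs hts := hK _ (by simpa using ht) _ (by simpa using hs) (by simpa using hts)

end

theorem halfMass_of_apFwdNegConst {p : ℝ} (hp : 1 < p) {F : Set (ℝ → ℝ≥0)}
    (hF : ∀ w ∈ F, ApFwdNeg p w) (hsup : (⨆ w ∈ F, apFwdNegConst p w) < ∞) :
    ∃ k : ℝ≥0, ∀ w ∈ F, HalfMass k (negMeasure w) := by
  lift (⨆ w ∈ F, apFwdNegConst p w) to ℝ≥0 using hsup.ne with M hM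
  exact ⟨6 ^ p * M, fun w hw => (hF w hw).halfMass hp (hM ▸ le_iSup₂_of_le w hw le_rfl)⟩

end

/-! ### The theorem on both half-lines -/

theorem mainTheorem4 {𝕜 : Type*} [RCLike 𝕜]
    {X : Type*} [NormedAddCommGroup X] [NormedSpace 𝕜 X] [CompleteSpace X]
    {Y : Type*} [NormedAddCommGroup Y] [NormedSpace 𝕜 Y] [NormedSpace ℝ Y] [IsScalarTower ℝ 𝕜 Y]
    [CompleteSpace Y]
    (p₀ : ℝ≥0∞) [Fact (1 ≤ p₀)] (hp₀ : 1 < p₀) (hp₀' : p₀ ≠ ∞)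
    (K : ℝ → ℝ → X →L[𝕜] Y) (r : ℝ) (hr : 1 < r) :
    (∀ T : Lp X p₀ (volume.restrict (Iic (0 : ℝ))) →L[𝕜] Lp Y p₀ (volume.restrict (Iic (0 : ℝ))),
      IsSingularIntegralOperator (Iic 0) T K →
      (∀ t ≤ 0, ∀ s ≤ 0, ¬ t < s → K t s = 0) →
      dNeg 1 K < ∞ → dNeg' r K < ∞ →
      (∀ p : ℝ, 0 < p → ∀ w : ℝ → ℝ≥0, AInftyFwdNeg w →
        ∃ C : ℝ≥0, CoifmanInequality (Iic 0) maxFwdNeg T r p w C) ∧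
      (∀ p : ℝ, 1 < p → ∀ F : Set (ℝ → ℝ≥0), (∀ w ∈ F, ApFwdNeg p w) →
        (⨆ w ∈ F, apFwdNegConst p w) < ∞ →
        ∃ C : ℝ≥0, ∀ w ∈ F, CoifmanInequality (Iic 0) maxFwdNeg T r p w C)) ∧
    (∀ T : Lp X p₀ (volume.restrict (Ici (0 : ℝ))) →L[𝕜] Lp Y p₀ (volume.restrict (Ici (0 : ℝ))),
      IsSingularIntegralOperator (Ici 0) T K →
      (∀ t ≥ 0, ∀ s ≥ 0, ¬ s < t → K t s = 0) →
      dPos 1 K < ∞ → dPos' r K < ∞ →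
      (∀ p : ℝ, 0 < p → ∀ w : ℝ → ℝ≥0, AInftyBwdPos w →
        ∃ C : ℝ≥0, CoifmanInequality (Ici 0) maxBwdPos T r p w C) ∧
      (∀ p : ℝ, 1 < p → ∀ F : Set (ℝ → ℝ≥0), (∀ w ∈ F, ApBwdPos p w) →
        (⨆ w ∈ F, apBwdPosConst p w) < ∞ →
        ∃ C : ℝ≥0, ∀ w ∈ F, CoifmanInequality (Ici 0) maxBwdPos T r p w C)) := by
  refine ⟨fun T hT hK hD hD' => ?_, fun T hT hK hD hD' => ?_⟩
  · have hS := hT.isForwardOperator hp₀' hK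
    have key : ∀ p : ℝ, 0 < p → ∀ k : ℝ≥0, ∃ C : ℝ≥0, ∀ w : ℝ → ℝ≥0, IsWeightOn (Iic 0) w →
        HalfMass k (negMeasure w) → CoifmanInequality (Iic 0) maxFwdNeg T r p w C := by
      intro p hp k
      obtain ⟨C, hC⟩ := hS.exists_coifman_const hD hr hD' hp k
      refine ⟨C, fun w hw hk f hf => ?_⟩
      rw [← opFun_eq T hf]
      exact hC w hw.aemeasurable hk f hf
    refine ⟨fun p hp w hw => ?_, fun p hp F hF hsup => ?_⟩
    · obtain ⟨k, hk⟩ := hw.exists_halfMass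
      obtain ⟨C, hC⟩ := key p hp k
      exact ⟨C, hC w hw.1 hk⟩
    · obtain ⟨k, hk⟩ := halfMass_of_apFwdNegConst hp hF hsup
      obtain ⟨C, hC⟩ := key p (one_pos.trans hp) k
      exact ⟨C, fun w hw => hC w (hF w hw).1 (hk w hw)⟩
  · have hS := hT.isForwardOperator_comp_neg hp₀' hK
    have key : ∀ p : ℝ, 0 < p → ∀ k : ℝ≥0, ∃ C : ℝ≥0, ∀ w : ℝ → ℝ≥0,
        IsWeightOn (Iic 0) (fun t => w (-t)) → HalfMass k (negMeasure fun t => w (-t)) →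
        CoifmanInequality (Ici 0) maxBwdPos T r p w C := by
      intro p hp k
      obtain ⟨C, hC⟩ := hS.exists_coifman_const ((dNeg_comp_neg_le 1 K).trans_lt hD) hr
        ((dNeg'_comp_neg_le r K).trans_lt hD') hp k
      refine ⟨C, fun w hw hk f hf => ?_⟩
      have h1 := hC _ hw.aemeasurable hk _ (hf.comp_neg (J := Iic 0) fun t ht => by simpa using ht)
      simp only [neg_neg] at h1
      rw [← opFun_eq T hf]
      simp only [setLIntegral_Ici_zero, maxBwdPos_neg]
      exact h1
    refine ⟨fun p hp w hw => ?_, fun p hp F hF hsup => ?_⟩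
    · obtain ⟨k, hk⟩ := hw.comp_neg.exists_halfMass
      obtain ⟨C, hC⟩ := key p hp k
      exact ⟨C, hC w hw.comp_neg.1 hk⟩
    -- The `A_p⁻` constants are by definition those of the reflected weights, so the reflected
    -- family has the same supremum.
    · obtain ⟨k, hk⟩ := halfMass_of_apFwdNegConst (F := (fun w t => w (-t)) '' F) hp
        (by rintro _ ⟨w, hw, rfl⟩; exact hF w hw) (by rw [iSup_image]; exact hsup)
      obtain ⟨C, hC⟩ := key p (one_pos.trans hp) k
      exact ⟨C, fun w hw => hC w (hF w hw).1 (hk _ ⟨w, hw, rfl⟩)⟩
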